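/- Let $\alpha>0$ and let $\{(X_t)_{t\ge 0};(\mathbb P_x)_{x>0}\}$ be a time-homogeneous Markov process (possibly killed) on $\mathbb R_+=(0,\infty)$, started at $x$ under $\mathbb P_x$, whose transition function has densities, $P_t(x,dy)=p_t(x,y)\,dy$, where $p_t(x,y)$ is positive and twice differentiable in $(t,x,y)\in(0,\infty)^3$. Under $\mathbb P_x$ the process $Y_t=t^\alpha X_{1/t}$, $t>0$, is Markov (in its own filtration), with transition densities, for $0<s<t$ and $a,b>0$, $$q^{(x)}_{s,t}(a,b)=t^{-\alpha}\,\frac{p_{1/t}\!\left(x,\frac{b}{t^\alpha}\right)\,p_{\frac1s-\frac1t}\!\left(\frac{b}{t^\alpha},\frac{a}{s^\alpha}\right)}{p_{1/s}\!\left(x,\frac{a}{s^\alpha}\right)};$$ it is called homogeneous if its transition probabilities from time $s$ to time $t$ (on the event that $Y_s$ is alive) depend on $(s,t)$ only through $t-s$. Two families of functions $p,\tilde p$ are in $h$-transform relationship if $p_t(x,y)=\frac{h(y)}{h(x)}e^{-\nu t}\,\tilde p_t(x,y)$ for all $t,x,y>0$, for some function $h:(0,\infty)\to(0,\infty)$ and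 some $\nu\in\mathbb R$. Then $(t^\alpha X_{1/t},t>0)$ is homogeneous under $\mathbb P_x$ for every $x>0$ if and only if there are a function $\phi$ on $(0,\infty)$ and constants $\beta\in\mathbb R$, $k>0$ such that $p$ is equal to, or is in $h$-transform relationship with, $$\tilde p_t(x,y)=t^{-\frac{\alpha}{2}(1+\beta)}\,\phi\!\left(\frac{xy}{t^\alpha}\right)y^\beta\exp\left\{-\frac{k^2}{2}\left(\frac{x^{2/\alpha}}{t}+\frac{y^{2/\alpha}}{t}\right)\right\}.$$ Moreover, in that case, for every such representation and every $x>0$, the process $(t^\alpha X_{1/t},t>0)$ is, under $\mathbb P_x$, a homogeneous Markov process with transition densities $$q^{(x)}_t(a,b)=\frac{\phi(xb)}{\phi(xa)}\exp\left(-t\,\frac{k^2}{2}\,x^{2/\alpha}\right)\tilde p_t(a,b),\qquad t,a,b>0,$$ and $q^{(x)}_{s,t}(a,b)=q^{(x)}_{t-s}(a,b)$ for all $0<s<t$ and $a,b>0$. In particular $\tilde p=p$ in this formula if $p$ itself has the displayed form. -/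

import Mathlib

open MeasureTheory ProbabilityTheory Set
open scoped ENNReal

noncomputable section

namespace TimeInversion

/-- The real line with an isolated cemetery point `Sum.inr ()` adjoined. A process on the half-line
`(0, ∞)` takes values here; a conservative process simply never visits the cemetery. -/
abbrev State : Type := ℝ ⊕ Unit

/-- The σ-algebra generated by `Y u` for the times `u ∈ T` with `u ≤ s`. -/
@[reducible]
def past {Ω : Type*} (T : Set ℝ) (Y : ℝ → Ω → State) (s : ℝ) : MeasurableSpace Ω :=
  ⨆ u ∈ T ∩ Iic s, MeasurableSpace.comap (Y u) inferInstance

/-- The event that the process is in the set `C ⊆ ℝ` at time `t` (in particular it is alive). -/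
def isIn {Ω : Type*} (Y : ℝ → Ω → State) (t : ℝ) (C : Set ℝ) : Set Ω :=
  Y t ⁻¹' (Sum.inl '' C)

/-- The measure with density `f` on the half-line `(0, ∞)`, evaluated at `C`. -/
def densityMass (f : ℝ → ℝ) (C : Set ℝ) : ℝ≥0∞ :=
  ∫⁻ y in C ∩ Ioi 0, ENNReal.ofReal (f y)

/-- `(X, (P x)_{x > 0})` is a time-homogeneous Markov process on `(0, ∞)`, possibly killed
(the cemetery being absorbing), with transition function `P_t(x, dy) = p t x y dy`:
under `P x` it starts at `x`, and for `0 ≤ s < t` the conditional probability of `X_t ∈ C` given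
the past up to time `s` is `∫_C p (t - s) X_s y dy`, and `0` if `X_s` is the cemetery. -/
structure IsMarkovProcess {Ω : Type*} [MeasurableSpace Ω]
    (p : ℝ → ℝ → ℝ → ℝ) (P : ℝ → Measure Ω) (X : ℝ → Ω → State) :
    Prop where
  isProbabilityMeasure : ∀ x, 0 < x → IsProbabilityMeasure (P x)
  measurable : ∀ t, 0 ≤ t → Measurable (X t)
  start : ∀ x, 0 < x → ∀ᵐ ω ∂(P x), X 0 ω = Sum.inl x
  markov : ∀ x, 0 < x → ∀ s t, 0 ≤ s → s < t →
    ∀ A, MeasurableSet[past (Ici 0) X s] A → ∀ C : Set ℝ, MeasurableSet C →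
      P x (A ∩ isIn X t C) =
        ∫⁻ ω in A, Sum.elim (fun a => densityMass (p (t - s) a) C) (fun _ => 0) (X s ω) ∂(P x)

/-- `p t x y` is twice differentiable in `(t, x, y) ∈ (0, ∞)³`. -/
def TwiceDifferentiable (p : ℝ → ℝ → ℝ → ℝ) : Prop :=
  DifferentiableOn ℝ (fun z : ℝ × ℝ × ℝ => p z.1 z.2.1 z.2.2)
      (Ioi 0 ×ˢ Ioi 0 ×ˢ Ioi 0) ∧
    DifferentiableOn ℝ (fderiv ℝ (fun z : ℝ × ℝ × ℝ => p z.1 z.2.1 z.2.2))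
      (Ioi 0 ×ˢ Ioi 0 ×ˢ Ioi 0)

/-- The time-inverted process `t ↦ t ^ α X_{1/t}`, used for `t > 0`. -/
def timeInverted {Ω : Type*} (α : ℝ) (X : ℝ → Ω → State) : ℝ → Ω → State :=
  fun t ω => Sum.map (fun y => t ^ α * y) id (X (1 / t) ω)

/-- `(Y_t)_{t > 0}` is Markov under `μ` with transition probabilities `κ s t a C`: for
`0 < s < t`, on the event that `Y_s` is not the cemetery, the conditional probability of
`Y_t ∈ C` given the past up to time `s` is `κ s t Y_s C`. -/
def HasTransitions {Ω : Type*} [MeasurableSpace Ω]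
    (Y : ℝ → Ω → State) (μ : Measure Ω)
    (κ : ℝ → ℝ → ℝ → Set ℝ → ℝ≥0∞) : Prop :=
  ∀ s t, 0 < s → s < t →
    ∀ A, MeasurableSet[past (Ioi 0) Y s] A → ∀ C : Set ℝ, MeasurableSet C →
      μ (A ∩ isIn Y s univ ∩ isIn Y t C) =
        ∫⁻ ω in A, Sum.elim (fun a => κ s t a C) (fun _ => 0) (Y s ω) ∂μ

/-- `(Y_t)_{t > 0}` is a homogeneous Markov process under `μ`: the transition probabilities
between times `s < t` can be chosen to depend on `t - s` only. -/
def IsHomogeneousMarkov {Ω : Type*} [MeasurableSpace Ω]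
    (Y : ℝ → Ω → State) (μ : Measure Ω) : Prop :=
  ∃ Q : ℝ → Kernel ℝ ℝ, (∀ r, IsMarkovKernel (Q r)) ∧
    HasTransitions Y μ (fun s t a C => Q (t - s) a C)

/-- `(Y_t)_{t > 0}` is a homogeneous Markov process under `μ` with transition densities
`q r a b`, `r > 0`, on `(0, ∞)`. -/
def HasHomogeneousDensities {Ω : Type*} [MeasurableSpace Ω]
    (Y : ℝ → Ω → State) (μ : Measure Ω) (q : ℝ → ℝ → ℝ → ℝ) : Prop :=
  HasTransitions Y μ (fun s t a C => densityMass (q (t - s) a) C)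

/-- The (a priori time-inhomogeneous) transition density `q_{s,t}^{(x)}(a, b)` of
`t ^ α X_{1/t}` under `P x`. -/
def invertedDensity (α : ℝ) (p : ℝ → ℝ → ℝ → ℝ) (x s t a b : ℝ) : ℝ :=
  t ^ (-α) * (p (1 / t) x (b / t ^ α) * p (1 / s - 1 / t) (b / t ^ α) (a / s ^ α)) /
    p (1 / s) x (a / s ^ α)

/-- `p` is obtained from `p₀` by Doob's `h`-transform with some `h > 0` and some `ν ∈ ℝ`.
This relation is symmetric. -/
def IsHTransform (p p₀ : ℝ → ℝ → ℝ → ℝ) : Prop :=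
  ∃ (h : ℝ → ℝ) (ν : ℝ), (∀ x, 0 < x → 0 < h x) ∧
    ∀ t x y, 0 < t → 0 < x → 0 < y → p t x y = h y / h x * Real.exp (-ν * t) * p₀ t x y

/-- `t^{-α(1+β)/2} φ(xy/t^α) y^β exp(-(k²/2) (x^{2/α}/t + y^{2/α}/t))`. -/
def modelDensity (α β k : ℝ) (φ : ℝ → ℝ) (t x y : ℝ) : ℝ :=
  t ^ (-(α / 2 * (1 + β))) * φ (x * y / t ^ α) * y ^ β *
    Real.exp (-(k ^ 2 / 2) * (x ^ (2 / α) / t + y ^ (2 / α) / t))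

end TimeInversion

end

/-! Time reversal of a Markov process with positive continuous densities gives a Markov process with
explicit transition densities, so the inverted process has the densities `invertedDensity`
(`IsMarkovProcess.hasTransitions_timeInverted`). Since these are continuous and every state is
charged, homogeneity forces `invertedDensity α p x s (s + r) a b` to be independent of `s` for all
positive arguments (`IsMarkovProcess.invertedDensity_stationary`); the converse is
`IsMarkovProcess.isHomogeneousMarkov`. What remains is a functional equation for `p`.

Put G_τ(x, y) = log p_τ(x^α, y^α). Stationarity is then an additive equation, solved by taking
differences that kill all unknown terms but one. Comparing two starting points shows that G_τ(x, y)
- G_τ(1, y) is affine in 1/τ when y/τ is fixed. Mixed second differences of G_1 are invariant under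
(x, y) ↦ (x/l, yl), which produces a function n(xy/τ). The coefficient of 1/τ must be quadratic, the
remaining dependence on y/τ logarithmic, and the remaining function of time affine plus a logarithm.
The outcome (`IsStationary.exists_form`) is G_τ(x, y) = n(xy/τ) - ντ - (α+β)/2 log τ + β log y +
u(x) - u(y) - κ(x² + y²)/τ, where u and ν make up the h-transform. Conversely u, ν and s cancel from
the inverted density of any such G, which gives the stated formula.

Stationarity alone allows any real κ. The Chapman-Kolmogorov inequality excludes κ ≤ 0
(`pos_of_chapmanKolmogorov`): it would make I = ∫ φ(z)² z^β dz finite, yet bound the integrand below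
by I²/z, which is not integrable on the half-line. -/

namespace TimeInversion

/-! ### Functional equations on the half-line -/

/-- A continuous function on `(0, ∞)` whose increments do not depend on the base point is affine. -/
theorem exists_affine_of_increments {f : ℝ → ℝ} (hf : ContinuousOn f (Ioi 0))
    (h : ∀ s t u, 0 < s → 0 < t → 0 < u → f (s + u) - f s = f (t + u) - f t) :
    ∃ c, ∀ t, 0 < t → f t = f 1 + c * (t - 1) := by
  have key : ∀ s t u, 0 < s → 0 < t → 0 < s + u → 0 < t + u →
      f (s + u) - f s = f (t + u) - f t := by
    intro s t u hs ht hsu htu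
    rcases lt_trichotomy u 0 with hu | rfl | hu
    · have := h (s + u) (t + u) (-u) hsu htu (by linarith)
      simp only [add_neg_cancel_right] at this
      linarith
    · simp
    · exact h s t u hs ht hu
  -- The increment over a step `u` does not depend on the base point, so it is additive in `u`. The
  -- base point `|u| + 1` keeps both arguments positive for every real `u` and varies continuously
  -- with `u`; a continuous additive map is linear.
  let D : ℝ →+ ℝ :=
    { toFun := fun u => f (|u| + 1 + u) - f (|u| + 1)
      map_zero' := by simp
      map_add' := by
        intro u v
        have hu := neg_abs_le u
        have hv := neg_abs_le v
        have huv := neg_abs_le (u + v)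
        have au := abs_nonneg u
        have av := abs_nonneg v
        have auv := abs_nonneg (u + v)
        have e1 := key (|u + v| + 1) (|u| + |v| + 1) (u + v) (by linarith) (by linarith)
          (by linarith) (by linarith)
        have e2 := key (|u| + 1) (|u| + |v| + 1) u (by linarith) (by linarith)
          (by linarith) (by linarith)
        have e3 := key (|v| + 1) (|u| + |v| + 1 + u) v (by linarith) (by linarith)
          (by linarith) (by linarith)
        have e4 : |u| + |v| + 1 + u + v = |u| + |v| + 1 + (u + v) := by ring
        rw [e4] at e3
        linarith }
  have hD : Continuous D := by
    have h1 : Continuous fun u : ℝ => f (|u| + 1 + u) :=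
      hf.comp_continuous (by fun_prop) fun u => by
        have := neg_abs_le u
        simp only [mem_Ioi]; linarith
    have h2 : Continuous fun u : ℝ => f (|u| + 1) :=
      hf.comp_continuous (by fun_prop) fun u => by
        have := abs_nonneg u
        simp only [mem_Ioi]; linarith
    exact h1.sub h2
  refine ⟨D 1, fun t ht => ?_⟩
  have e := (D.toRealLinearMap hD).map_smul (t - 1) 1
  simp only [smul_eq_mul, mul_one] at e
  have e' : D (t - 1) = (t - 1) * D 1 := e
  have hlow := neg_abs_le (t - 1)
  have habs := abs_nonneg (t - 1)
  have e2 : D (t - 1) = f (1 + (t - 1)) - f 1 :=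
    key _ _ _ (by linarith) one_pos (by linarith) (by linarith)
  rw [add_sub_cancel] at e2
  linarith

/-- A continuous function on `(0, ∞)` whose multiplicative increments do not depend on the base
point is an affine function of the logarithm. -/
theorem exists_log_of_increments {f : ℝ → ℝ} (hf : ContinuousOn f (Ioi 0))
    (h : ∀ a b, 0 < a → 0 < b → f (a * b) - f b = f a - f 1) :
    ∃ c, ∀ t, 0 < t → f t = f 1 + c * Real.log t := by
  -- The substitution t = exp u reduces the equation to Cauchy's additive one.
  let D : ℝ →+ ℝ :=
    { toFun := fun u => f (Real.exp u) - f 1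
      map_zero' := by simp
      map_add' := by
        intro u v
        have := h _ _ (Real.exp_pos u) (Real.exp_pos v)
        rw [← Real.exp_add] at this
        linarith }
  have hD : Continuous D :=
    (hf.comp_continuous Real.continuous_exp fun u => Real.exp_pos u).sub continuous_const
  refine ⟨D 1, fun t ht => ?_⟩
  have e := (D.toRealLinearMap hD).map_smul (Real.log t) 1
  simp only [smul_eq_mul, mul_one] at e
  have e' : D (Real.log t) = Real.log t * D 1 := e
  have e2 : D (Real.log t) = f (Real.exp (Real.log t)) - f 1 := rfl
  rw [Real.exp_log ht] at e2
  linarith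

/-- A differentiable function on `(0, ∞)²` whose mixed second differences are invariant under
`(x, y) ↦ (x / l, y * l)` has the mixed differences of a function of `x * y`. -/
theorem exists_mul_of_mixed_differences {f : ℝ → ℝ → ℝ} {f' : ℝ → ℝ}
    (hf' : ∀ x, 0 < x → HasDerivAt (f x) (f' x) 1) (hcont : ContinuousOn f' (Ioi 0))
    (hinv : ∀ x x' y y' l, 0 < x → 0 < x' → 0 < y → 0 < y' → 0 < l →
      f (x / l) (y * l) - f (x' / l) (y * l) - f (x / l) (y' * l) + f (x' / l) (y' * l) =
        f x y - f x' y - f x y' + f x' y') :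
    ∃ n : ℝ → ℝ, ContinuousOn n (Ioi 0) ∧ ∀ x y, 0 < x → 0 < y →
      f x y - f x 1 - f 1 y + f 1 1 = n (x * y) - n x - n y + n 1 := by
  let c : ℝ → ℝ → ℝ := fun x y => f x y - f x 1 - f 1 y + f 1 1
  -- This is the derivative of the desired `n`: it satisfies x m(xy) - m(y) = (f'(xy) - f'(y))/y,
  -- which is the derivative of `c x` found in `hcd`.
  let m : ℝ → ℝ := fun x => (f' x - f' 1) / x
  have hm : ContinuousOn m (Ioi 0) :=
    (hcont.sub continuousOn_const).div continuousOn_id fun x hx => (ne_of_gt hx)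
  let n : ℝ → ℝ := fun x => ∫ z in (1 : ℝ)..x, m z
  have hn : ∀ x, 0 < x → HasDerivAt n (m x) x := by
    intro x hx
    refine intervalIntegral.integral_hasDerivAt_right ?_ ?_ (hm.continuousAt (Ioi_mem_nhds hx))
    · refine (hm.mono fun z hz => ?_).intervalIntegrable
      have := hz.1
      exact lt_of_lt_of_le (lt_min one_pos hx) this
    · exact hm.stronglyMeasurableAtFilter isOpen_Ioi x hx
  -- The invariance with points xy, y and z, 1 and factor l = y is a 2-cocycle identity for the
  -- multiplicative group.
  have hcoc : ∀ x y z, 0 < x → 0 < y → 0 < z → c x (y * z) = c x y + c (x * y) z - c y z := by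
    intro x y z hx hy hz
    have := hinv (x * y) y z 1 y (by positivity) hy hz one_pos hy
    rw [mul_div_cancel_right₀ _ hy.ne', div_self hy.ne', one_mul, mul_comm z y] at this
    simp only [c]
    linarith
  have hc1 : ∀ x, 0 < x → HasDerivAt (c x) (f' x - f' 1) 1 := by
    intro x hx
    simpa [c] using (((hf' x hx).sub_const (f x 1)).sub (hf' 1 one_pos)).add_const (f 1 1)
  -- Differentiating the cocycle identity in its last variable at 1 transports the derivative of `c`
  -- from the point 1 to any `y`. Hence `c` and the coboundary of `n` have the same derivative in
  -- `y`, and both vanish at y = 1.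
  have hcd : ∀ x y, 0 < x → 0 < y →
      HasDerivAt (c x) ((f' (x * y) - f' y) / y) y := by
    intro x y hx hy
    have h1 : HasDerivAt (fun v => c x y + c (x * y) (v / y) - c y (v / y))
        ((f' (x * y) - f' y) / y) y := by
      have hd : HasDerivAt (fun v : ℝ => v / y) (1 / y) y := (hasDerivAt_id y).div_const y
      have a1 : HasDerivAt (c (x * y)) (f' (x * y) - f' 1) (y / y) := by
        rw [div_self hy.ne']; exact hc1 _ (by positivity)
      have a2 : HasDerivAt (c y) (f' y - f' 1) (y / y) := by
        rw [div_self hy.ne']; exact hc1 _ hy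
      have := ((HasDerivAt.comp (h := fun v : ℝ => v / y) y a1 hd).const_add (c x y)).sub
        (HasDerivAt.comp (h := fun v : ℝ => v / y) y a2 hd)
      refine this.congr_deriv ?_
      ring
    refine h1.congr_of_eventuallyEq ?_
    filter_upwards [Ioi_mem_nhds hy] with v hv
    have hv' : 0 < v := hv
    have := hcoc x y (v / y) hx hy (by positivity)
    rwa [mul_div_cancel₀ _ hy.ne'] at this
  refine ⟨n, fun x hx => (hn x hx).continuousAt.continuousWithinAt, fun x y hx hy => ?_⟩
  have hd : ∀ v, 0 < v → HasDerivAt (fun v => c x v - (n (x * v) - n x - n v + n 1)) 0 v := by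
    intro v hv
    have hxv : HasDerivAt (fun v => x * v) x v := by simpa using (hasDerivAt_id v).const_mul x
    have b1 := (hn (x * v) (by positivity)).comp v hxv
    have := (hcd x v hx hv).sub (((b1.sub_const (n x)).sub (hn v hv)).add_const (n 1))
    refine this.congr_deriv ?_
    simp only [m]
    field_simp
    ring
  have hconst := isOpen_Ioi.is_const_of_deriv_eq_zero isPreconnected_Ioi
    (fun v hv => (hd v hv).differentiableAt.differentiableWithinAt)
    (fun v hv => (hd v hv).deriv) (mem_Ioi.2 hy) (mem_Ioi.2 one_pos)
  simp only [c, mul_one] at hconst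
  linarith

/-! ### The stationarity equation for the log-density -/

/-- The logarithm of the inverted density, in terms of `G t x y = log (p t (x ^ α) (y ^ α))`. -/
noncomputable def invertedLog (α : ℝ) (G : ℝ → ℝ → ℝ → ℝ) (x s t a b : ℝ) : ℝ :=
  -α * Real.log t + G (1 / t) x (b / t) + G (1 / s - 1 / t) (b / t) (a / s) - G (1 / s) x (a / s)

/-- The inverted log-density depends on the two times only through their difference. -/
def IsStationary (α : ℝ) (G : ℝ → ℝ → ℝ → ℝ) : Prop :=
  ∀ x s s' r a b, 0 < x → 0 < s → 0 < s' → 0 < r → 0 < a → 0 < b →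
    invertedLog α G x s (s + r) a b = invertedLog α G x s' (s' + r) a b

theorem one_div_sub_one_div_add_pos {s r : ℝ} (hs : 0 < s) (hr : 0 < r) :
    0 < 1 / s - 1 / (s + r) :=
  sub_pos.2 (one_div_lt_one_div_of_lt hs (by linarith))

theorem continuousOn_section {G : ℝ → ℝ → ℝ → ℝ}
    (hG : ContinuousOn (fun z : ℝ × ℝ × ℝ => G z.1 z.2.1 z.2.2) (Ioi 0 ×ˢ Ioi 0 ×ˢ Ioi 0))
    {a b c : ℝ → ℝ} (ha : ContinuousOn a (Ioi 0)) (hb : ContinuousOn b (Ioi 0))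
    (hc : ContinuousOn c (Ioi 0)) (ha' : ∀ t, 0 < t → 0 < a t) (hb' : ∀ t, 0 < t → 0 < b t)
    (hc' : ∀ t, 0 < t → 0 < c t) : ContinuousOn (fun t => G (a t) (b t) (c t)) (Ioi 0) :=
  hG.comp (f := fun t => (a t, b t, c t)) (ha.prodMk (hb.prodMk hc))
    fun t ht => ⟨ha' t ht, hb' t ht, hc' t ht⟩

theorem continuousOn_const_div (c : ℝ) : ContinuousOn (fun t : ℝ => c / t) (Ioi 0) :=
  continuousOn_const.div continuousOn_id fun _ ht => ne_of_gt ht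

/-- Subtracting the stationarity equations for the starting points `x` and 1 removes the middle
term, which does not involve the starting point. What is left says that g(t, b) = G(1/t, x, b/t) -
G(1/t, 1, b/t) has time increments independent of the base time and of `b`. So g is affine in t with
a slope `c x` free of `b`; then t = 1/τ and b = y/τ. -/
theorem IsStationary.exists_time_split {α : ℝ} {G : ℝ → ℝ → ℝ → ℝ} (h : IsStationary α G)
    (hG : ContinuousOn (fun z : ℝ × ℝ × ℝ => G z.1 z.2.1 z.2.2) (Ioi 0 ×ˢ Ioi 0 ×ˢ Ioi 0)) :
    ∃ c : ℝ → ℝ, ContinuousOn c (Ioi 0) ∧ ∀ τ x y, 0 < τ → 0 < x → 0 < y →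
      G τ x y = G τ 1 y + c x / τ + (G 1 x (y / τ) - G 1 1 (y / τ) - c x) := by
  refine ⟨fun x => G (1 / 2) x (1 / 2) - G (1 / 2) 1 (1 / 2) - (G 1 x 1 - G 1 1 1), ?_, ?_⟩
  · refine ((continuousOn_section hG continuousOn_const continuousOn_id continuousOn_const ?_ ?_
      ?_).sub continuousOn_const).sub ((continuousOn_section hG continuousOn_const continuousOn_id
      continuousOn_const ?_ ?_ ?_).sub continuousOn_const) <;> intro t ht <;> simp [ht]
  intro τ x y hτ hx hy
  let g : ℝ → ℝ → ℝ := fun t b => G (1 / t) x (b / t) - G (1 / t) 1 (b / t)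
  have hg : ∀ s s' r a b, 0 < s → 0 < s' → 0 < r → 0 < a → 0 < b →
      g (s + r) b - g s a = g (s' + r) b - g s' a := by
    intro s s' r a b hs hs' hr ha hb
    have e1 := h x s s' r a b hx hs hs' hr ha hb
    have e2 := h 1 s s' r a b one_pos hs hs' hr ha hb
    simp only [invertedLog] at e1 e2
    simp only [g]
    linarith
  have hlt : ∀ s t u a b, 0 < s → s < t → 0 < u → 0 < a → 0 < b →
      g (s + u) a - g s a = g (t + u) b - g t b := by
    intro s t u a b hs hst hu ha hb
    have := hg s (s + u) (t - s) a b hs (by linarith) (by linarith) ha hb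
    rw [show s + (t - s) = t by ring, show s + u + (t - s) = t + u by ring] at this
    linarith
  have hinc : ∀ s t u a b, 0 < s → 0 < t → 0 < u → 0 < a → 0 < b →
      g (s + u) a - g s a = g (t + u) b - g t b := by
    intro s t u a b hs ht hu ha hb
    have hm : 0 < min s t / 2 := by have := lt_min hs ht; linarith
    have h1 : min s t / 2 < s := by have := min_le_left s t; linarith
    have h2 : min s t / 2 < t := by have := min_le_right s t; linarith
    exact (hlt _ s u 1 a hm h1 hu one_pos ha).symm.trans (hlt _ t u 1 b hm h2 hu one_pos hb)
  have hb : 0 < y / τ := by positivity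
  have hgc : ContinuousOn (fun t => g t (y / τ)) (Ioi 0) := by
    refine (continuousOn_section hG (continuousOn_const_div 1) continuousOn_const
      (continuousOn_const_div _) ?_ ?_ ?_).sub (continuousOn_section hG (continuousOn_const_div 1)
      continuousOn_const (continuousOn_const_div _) ?_ ?_ ?_) <;> intro t ht <;> positivity
  obtain ⟨c, hc⟩ := exists_affine_of_increments hgc
    fun s t u hs ht hu => hinc s t u _ _ hs ht hu hb hb
  have hc2 := hc 2 two_pos
  have hct := hc (1 / τ) (by positivity)
  have h12 := hinc 1 1 1 1 (y / τ) one_pos one_pos one_pos one_pos hb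
  norm_num [g] at hc2 hct h12
  rw [div_mul_cancel₀ _ hτ.ne'] at hct
  norm_num
  rw [div_eq_mul_inv _ τ]
  linear_combination hct - (τ⁻¹ - 1) * h12 - (τ⁻¹ - 1) * hc2

/-- Stationarity is used on [t - r, t] for t = l and t = 1, with initial state ar and final state b.
After `exists_time_split` the only term coupling a and b is G(1, b/t, at), because the initial state
was scaled so that (ar/(t-r)) / (1/(t-r) - 1/t) = at. A mixed difference in (a, b) leaves only this
term. -/
theorem IsStationary.mixed_differences {α : ℝ} {G : ℝ → ℝ → ℝ → ℝ} (h : IsStationary α G)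
    {c : ℝ → ℝ} (hc : ∀ τ x y, 0 < τ → 0 < x → 0 < y →
      G τ x y = G τ 1 y + c x / τ + (G 1 x (y / τ) - G 1 1 (y / τ) - c x))
    {x x' y y' l : ℝ} (hx : 0 < x) (hx' : 0 < x') (hy : 0 < y) (hy' : 0 < y') (hl : 0 < l) :
    G 1 (x / l) (y * l) - G 1 (x' / l) (y * l) - G 1 (x / l) (y' * l) + G 1 (x' / l) (y' * l) =
      G 1 x y - G 1 x' y - G 1 x y' + G 1 x' y' := by
  obtain ⟨r, hr, hrl, hr1⟩ : ∃ r, 0 < r ∧ r < l ∧ r < 1 := by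
    obtain ⟨r, h1, h2⟩ := exists_between (lt_min hl one_pos)
    exact ⟨r, h1, lt_of_lt_of_le h2 (min_le_left _ _), lt_of_lt_of_le h2 (min_le_right _ _)⟩
  have key : ∀ t b a, r < t → 0 < a → 0 < b →
      G (1 / (t - r) - 1 / (t - r + r)) (b / (t - r + r)) (a * r / (t - r)) =
        G (1 / (t - r) - 1 / t) 1 (a * r / (t - r)) + c (b / t) / (1 / (t - r) - 1 / t) +
        (G 1 (b / t) (a * t) - G 1 1 (a * t) - c (b / t)) := by
    intro t b a hrt ha hb
    have ht : 0 < t := hr.trans hrt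
    have htr : 0 < t - r := by linarith
    have hp := one_div_sub_one_div_add_pos htr hr
    rw [sub_add_cancel] at hp ⊢
    rw [hc _ _ _ hp (by positivity) (by positivity)]
    have : a * r / (t - r) / (1 / (t - r) - 1 / t) = a * t := by
      rw [div_eq_iff hp.ne']
      field_simp
      ring
    rw [this]
  have hl' : 0 < l - r := by linarith
  have h1' : 0 < 1 - r := by linarith
  have e := fun b a ha hb => h 1 (l - r) (1 - r) r (a * r) b one_pos hl' h1' hr ha hb
  simp only [invertedLog] at e
  have e1 := e x y (by positivity) hx
  have e2 := e x' y (by positivity) hx'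
  have e3 := e x y' (by positivity) hx
  have e4 := e x' y' (by positivity) hx'
  rw [key _ _ _ hrl hy hx, key _ _ _ hr1 hy hx] at e1
  rw [key _ _ _ hrl hy hx', key _ _ _ hr1 hy hx'] at e2
  rw [key _ _ _ hrl hy' hx, key _ _ _ hr1 hy' hx] at e3
  rw [key _ _ _ hrl hy' hx', key _ _ _ hr1 hy' hx'] at e4
  simp only [mul_one, div_one] at e1 e2 e3 e4
  linarith

theorem IsStationary.exists_mul_split {α : ℝ} {G : ℝ → ℝ → ℝ → ℝ} (h : IsStationary α G)
    (hG : ContinuousOn (fun z : ℝ × ℝ × ℝ => G z.1 z.2.1 z.2.2) (Ioi 0 ×ˢ Ioi 0 ×ˢ Ioi 0))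
    {G' : ℝ → ℝ} (hG' : ∀ x, 0 < x → HasDerivAt (G 1 x) (G' x) 1)
    (hcont : ContinuousOn G' (Ioi 0)) :
    ∃ (w : ℝ → ℝ → ℝ) (c u n : ℝ → ℝ), ContinuousOn u (Ioi 0) ∧ ContinuousOn n (Ioi 0) ∧
      ∀ τ x y, 0 < τ → 0 < x → 0 < y → G τ x y = w τ y + c x / τ + u x + n (x * y / τ) := by
  obtain ⟨c, hcc, hc⟩ := h.exists_time_split hG
  obtain ⟨n, hn, hn'⟩ := exists_mul_of_mixed_differences hG' hcont
    fun x x' y y' l hx hx' hy hy' hl => h.mixed_differences hc hx hx' hy hy' hl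
  refine ⟨fun τ y => G τ 1 y - n (y / τ), c, fun x => G 1 x 1 - G 1 1 1 - c x - n x + n 1, n,
    ?_, hn, ?_⟩
  · refine ((((continuousOn_section hG continuousOn_const continuousOn_id continuousOn_const ?_ ?_
      ?_).sub continuousOn_const).sub hcc).sub hn).add continuousOn_const <;>
      intro t ht <;> simp [ht]
  intro τ x y hτ hx hy
  have h1 := hn' x (y / τ) hx (by positivity)
  rw [← mul_div_assoc] at h1
  rw [hc τ x y hτ hx hy]
  linarith

/-- For final states b and 1 and initial state 1, the difference of the two inverted log-densities
is affine in 1/r, up to terms depending only on b and r. Stationarity therefore equates two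
coefficients: one makes `c` quadratic, the other makes the rest of `w` a function of τ plus a
function of y/τ. -/
theorem IsStationary.exists_square_split {α : ℝ} {G : ℝ → ℝ → ℝ → ℝ} (h : IsStationary α G)
    {w : ℝ → ℝ → ℝ} {c u n : ℝ → ℝ}
    (hw : ∀ τ x y, 0 < τ → 0 < x → 0 < y → G τ x y = w τ y + c x / τ + u x + n (x * y / τ)) :
    ∃ (g ε : ℝ → ℝ) (κ : ℝ), ∀ τ x y, 0 < τ → 0 < x → 0 < y →
      G τ x y = g τ + ε (y / τ) + n (x * y / τ) + u x - u y - κ * (x ^ 2 + y ^ 2) / τ := by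
  let K : ℝ → ℝ → ℝ := fun b t =>
    w (1 / t) (b / t) + u (b / t) - w (1 / t) (1 / t) - u (1 / t)
  let C : ℝ → ℝ → ℝ := fun b t => c (b / t) - c (1 / t)
  have hlog : ∀ t r b, 0 < r → r < t → 0 < b →
      invertedLog α G 1 (t - r) (t - r + r) 1 b - invertedLog α G 1 (t - r) (t - r + r) 1 1 =
        C b t * (t ^ 2 / r - t) + K b t + n b + n (b / r) - n 1 - n (1 / r) := by
    intro t r b hr hrt hb
    have ht : 0 < t := hr.trans hrt
    have htr : 0 < t - r := by linarith
    have hp := one_div_sub_one_div_add_pos htr hr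
    rw [sub_add_cancel] at hp ⊢
    have e1 : ∀ b : ℝ, 1 * (b / t) / (1 / t) = b := fun b => by field_simp
    have e2 : ∀ b : ℝ, b / t * (1 / (t - r)) / (1 / (t - r) - 1 / t) = b / r := fun b => by
      rw [div_eq_iff hp.ne']; field_simp; ring
    have e3 : ∀ z : ℝ, z / (1 / (t - r) - 1 / t) = z * (t ^ 2 / r - t) := fun z => by
      rw [div_eq_iff hp.ne']; field_simp; ring
    simp only [invertedLog]
    rw [hw _ 1 (b / t) (by positivity) one_pos (by positivity),
      hw _ 1 (1 / t) (by positivity) one_pos (by positivity),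
      hw _ (b / t) _ hp (by positivity) (by positivity),
      hw _ (1 / t) _ hp (by positivity) (by positivity), e1, e1, e2, e2, e3, e3]
    simp only [C, K]
    ring
  have hst : ∀ t r b, 0 < r → r < t → r < 1 → 0 < b →
      C b t * (t ^ 2 / r - t) + K b t = C b 1 * (1 / r - 1) + K b 1 := by
    intro t r b hr hrt hr1 hb
    have e1 := hlog t r b hr hrt hb
    have e2 := hlog 1 r b hr hr1 hb
    rw [h 1 (t - r) (1 - r) r 1 b one_pos (by linarith) (by linarith) hr one_pos hb,
      h 1 (t - r) (1 - r) r 1 1 one_pos (by linarith) (by linarith) hr one_pos one_pos] at e1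
    rw [one_pow] at e2
    linarith
  have hCK : ∀ t b, 0 < t → 0 < b → C b t * t ^ 2 = C b 1 ∧
      K b t - C b t * t = K b 1 - C b 1 := by
    -- Two affine functions of 1/r agree at `r` and at `r / 2`, so their coefficients are equal.
    intro t b ht hb
    obtain ⟨r, hr, hrt, hr1⟩ : ∃ r, 0 < r ∧ r < t ∧ r < 1 := by
      obtain ⟨r, h1, h2⟩ := exists_between (lt_min ht one_pos)
      exact ⟨r, h1, lt_of_lt_of_le h2 (min_le_left _ _), lt_of_lt_of_le h2 (min_le_right _ _)⟩
    have e1 := hst t r b hr hrt hr1 hb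
    have e2 := hst t (r / 2) b (by linarith) (by linarith) (by linarith) hb
    have h1 : C b t * t ^ 2 = C b 1 := by
      field_simp at e1 e2
      nlinarith
    refine ⟨h1, ?_⟩
    have h2 : C b t * (t ^ 2 / r) = C b 1 * (1 / r) := by
      rw [← h1]; ring
    linear_combination e1 - h2
  have hc : ∀ b l, 0 < b → 0 < l → c (b * l) - c l = l ^ 2 * (c b - c 1) := by
    intro b l hb hl
    have := (hCK (1 / l) b (by positivity) hb).1
    simp only [C, div_div_eq_mul_div, div_one, one_mul] at this
    field_simp at this
    linarith
  -- Evaluating c(2b) through `hc` once with factor 2 and once with factor b gives 3(c(b) - c(1)) =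
  -- (b² - 1)(c(2) - c(1)).
  let κ : ℝ := -(c 2 - c 1) / 3
  have hcκ : ∀ b, 0 < b → c b = c 1 - κ * (b ^ 2 - 1) := by
    intro b hb
    have e1 := hc b 2 hb two_pos
    have e2 := hc 2 b two_pos hb
    rw [mul_comm 2 b] at e2
    simp only [κ]
    linarith
  refine ⟨fun τ => w τ τ + u τ + κ * τ + (c 1 + κ) / τ, fun b => K b 1 - C b 1, κ, ?_⟩
  intro τ x y hτ hx hy
  -- With t = 1/τ and b = y/τ, the reference final state 1 corresponds to the space variable 1/t =
  -- τ; this is why `w τ τ` and `u τ` enter the time factor.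
  have e := (hCK (1 / τ) (y / τ) (by positivity) (by positivity)).2
  have e1 : C (y / τ) (1 / τ) = c y - c τ := by
    simp only [C, div_div_eq_mul_div, div_one, one_mul, div_mul_cancel₀ _ hτ.ne']
  have e2 : K (y / τ) (1 / τ) = w τ y + u y - w τ τ - u τ := by
    simp only [K, div_div_eq_mul_div, div_one, one_mul, div_mul_cancel₀ _ hτ.ne']
  rw [e1, e2, hcκ y hy, hcκ τ hτ] at e
  rw [hw τ x y hτ hx hy, hcκ x hx]
  beta_reduce
  rw [← e]
  field_simp
  ring

theorem invertedLog_of_split {α κ : ℝ} {G : ℝ → ℝ → ℝ → ℝ} {g ε n u : ℝ → ℝ}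
    (hG : ∀ τ x y, 0 < τ → 0 < x → 0 < y →
      G τ x y = g τ + ε (y / τ) + n (x * y / τ) + u x - u y - κ * (x ^ 2 + y ^ 2) / τ)
    {x s r a b : ℝ} (hx : 0 < x) (hs : 0 < s) (hr : 0 < r) (ha : 0 < a) (hb : 0 < b) :
    invertedLog α G x s (s + r) a b =
      -α * Real.log (s + r) + g (1 / (s + r)) + g (1 / s - 1 / (s + r)) - g (1 / s) + ε b +
        ε (a * (s + r) / r) - ε a + n (x * b) - n (x * a) + n (a * b / r) -
        κ * (x ^ 2 * r + (a ^ 2 + b ^ 2) / r) := by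
  obtain ⟨t, rfl⟩ : ∃ t, s = t - r := ⟨s + r, by ring⟩
  have hp := one_div_sub_one_div_add_pos hs hr
  rw [sub_add_cancel] at hp ⊢
  have ht : 0 < t := by linarith
  have e1 : b / t / (1 / t) = b := by field_simp
  have e2 : a / (t - r) / (1 / (t - r)) = a := by field_simp
  have e3 : x * (b / t) / (1 / t) = x * b := by field_simp
  have e4 : x * (a / (t - r)) / (1 / (t - r)) = x * a := by field_simp
  have e5 : a / (t - r) / (1 / (t - r) - 1 / t) = a * t / r := by
    rw [div_eq_iff hp.ne']; field_simp; ring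
  have e6 : b / t * (a / (t - r)) / (1 / (t - r) - 1 / t) = a * b / r := by
    rw [div_eq_iff hp.ne']; field_simp; ring
  have e7 : κ * ((b / t) ^ 2 + (a / (t - r)) ^ 2) / (1 / (t - r) - 1 / t) =
      κ * ((b / t) ^ 2 + (a / (t - r)) ^ 2) * (t * (t - r) / r) := by
    rw [div_eq_iff hp.ne']; field_simp; ring
  simp only [invertedLog]
  rw [hG _ x _ (by positivity) hx (by positivity), hG _ _ _ hp (by positivity) (by positivity),
    hG _ x _ (by positivity) hx (by positivity), e1, e2, e3, e4, e5, e6, e7]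
  field_simp
  ring

/-- The term ε(a(s + r)/r) is the only one linking the initial state to the absolute time. With
initial state ar and terminal times b and 1 it equals ε(ab) and ε(a); comparing with initial state r
gives the logarithmic Cauchy equation. -/
theorem IsStationary.exists_log_split {α κ : ℝ} {G : ℝ → ℝ → ℝ → ℝ} (h : IsStationary α G)
    {g ε n u : ℝ → ℝ} (hε : ContinuousOn ε (Ioi 0))
    (hG : ∀ τ x y, 0 < τ → 0 < x → 0 < y →
      G τ x y = g τ + ε (y / τ) + n (x * y / τ) + u x - u y - κ * (x ^ 2 + y ^ 2) / τ) :
    ∃ β, ∀ y, 0 < y → ε y = ε 1 + β * Real.log y := by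
  refine exists_log_of_increments hε fun a b ha hb => ?_
  obtain ⟨r, hr, hrb, hr1⟩ : ∃ r, 0 < r ∧ r < b ∧ r < 1 := by
    obtain ⟨r, h1, h2⟩ := exists_between (lt_min hb one_pos)
    exact ⟨r, h1, lt_of_lt_of_le h2 (min_le_left _ _), lt_of_lt_of_le h2 (min_le_right _ _)⟩
  have hbr : 0 < b - r := by linarith
  have h1r : 0 < 1 - r := by linarith
  have har : 0 < a * r := by positivity
  have e1 := h 1 (b - r) (1 - r) r (a * r) 1 one_pos hbr h1r hr har one_pos
  have e2 := h 1 (b - r) (1 - r) r r 1 one_pos hbr h1r hr hr one_pos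
  rw [invertedLog_of_split hG one_pos hbr hr har one_pos,
    invertedLog_of_split hG one_pos h1r hr har one_pos] at e1
  rw [invertedLog_of_split hG one_pos hbr hr hr one_pos,
    invertedLog_of_split hG one_pos h1r hr hr one_pos] at e2
  rw [sub_add_cancel, sub_add_cancel, mul_right_comm a r b, mul_div_cancel_right₀ _ hr.ne',
    mul_right_comm a r 1, mul_div_cancel_right₀ _ hr.ne'] at e1
  rw [mul_one a] at e1
  rw [sub_add_cancel, sub_add_cancel, mul_div_cancel_left₀ _ hr.ne',
    mul_div_cancel_left₀ _ hr.ne'] at e2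
  linarith

/-- If `f x + f y - f (x + y)` depends only on `1 / x - 1 / (x + y)`, then `f` is affine. -/
theorem exists_affine_of_cocycle {f : ℝ → ℝ} (hf : ContinuousOn f (Ioi 0))
    (h : ∀ x y x' y', 0 < x → 0 < y → 0 < x' → 0 < y' →
      1 / x - 1 / (x + y) = 1 / x' - 1 / (x' + y') →
      f x + f y - f (x + y) = f x' + f y' - f (x' + y')) :
    ∃ c, ∀ t, 0 < t → f t = f 1 + c * (t - 1) := by
  have hconst : ∀ x y, 0 < x → 0 < y → f x + f y - f (x + y) = f 1 + f 1 - f (1 + 1) := by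
    intro x y hx hy
    have hR := one_div_sub_one_div_add_pos hx hy
    -- The expression is symmetric in x and y while 1/x - 1/(x+y) is not. The pair 1/(q(1+2q)),
    -- 2/(1+2q) has sum 1/q and parameter 2q² in this order, but 1/2 in the other order, which is
    -- the parameter of (1, 1). So all values agree with the one at (1, 1).
    obtain ⟨q, hq, hqR⟩ : ∃ q, 0 < q ∧ 2 * q ^ 2 = 1 / x - 1 / (x + y) :=
      ⟨√((1 / x - 1 / (x + y)) / 2), by positivity, by rw [Real.sq_sqrt (by positivity)]; ring⟩
    have h1 : 0 < 1 / (q * (1 + 2 * q)) := by positivity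
    have h2 : 0 < 2 / (1 + 2 * q) := by positivity
    have hsum : 1 / (q * (1 + 2 * q)) + 2 / (1 + 2 * q) = 1 / q := by
      field_simp
    have e1 := h x y _ _ hx hy h1 h2 (by rw [hsum, ← hqR]; field_simp; ring)
    have e2 := h _ _ 1 1 h2 h1 one_pos one_pos
      (by rw [add_comm (2 / (1 + 2 * q)), hsum]; field_simp; ring)
    rw [add_comm (2 / (1 + 2 * q)) (1 / _)] at e2
    linear_combination e1 + e2
  refine exists_affine_of_increments hf fun s t u hs ht hu => ?_
  have e1 := hconst s u hs hu
  have e2 := hconst t u ht hu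
  linarith

/-- The general solution of the stationarity equation. -/
theorem IsStationary.exists_form {α : ℝ} {G : ℝ → ℝ → ℝ → ℝ} (h : IsStationary α G)
    (hG : ContinuousOn (fun z : ℝ × ℝ × ℝ => G z.1 z.2.1 z.2.2) (Ioi 0 ×ˢ Ioi 0 ×ˢ Ioi 0))
    {G' : ℝ → ℝ} (hG' : ∀ x, 0 < x → HasDerivAt (G 1 x) (G' x) 1)
    (hcont : ContinuousOn G' (Ioi 0)) :
    ∃ (n u : ℝ → ℝ) (β κ ν : ℝ), ∀ τ x y, 0 < τ → 0 < x → 0 < y →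
      G τ x y = n (x * y / τ) - ν * τ - (α + β) / 2 * Real.log τ + β * Real.log y + u x - u y -
        κ * (x ^ 2 + y ^ 2) / τ := by
  obtain ⟨w, c, u, n, hu, hn, hw⟩ := h.exists_mul_split hG hG' hcont
  obtain ⟨g, ε, κ, hS⟩ := h.exists_square_split hw
  have hε : ContinuousOn ε (Ioi 0) := by
    have hc : ContinuousOn (fun y => G 1 1 y - n y + u y + κ * (1 + y ^ 2) - g 1 - u 1) (Ioi 0) := by
      refine (((((continuousOn_section hG continuousOn_const continuousOn_const continuousOn_id
        ?_ ?_ ?_).sub hn).add hu).add (by fun_prop)).sub continuousOn_const).sub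
        continuousOn_const <;> intro t ht <;> simp [ht]
    refine hc.congr fun y hy => ?_
    have := hS 1 1 y one_pos one_pos hy
    simp only [div_one, one_mul, one_pow] at this
    linarith
  obtain ⟨β, hβ⟩ := h.exists_log_split hε hS
  have hg : ContinuousOn g (Ioi 0) := by
    have hi : ContinuousOn (fun τ : ℝ => 1 / τ) (Ioi 0) := continuousOn_const_div 1
    have hm : MapsTo (fun τ : ℝ => 1 / τ) (Ioi 0) (Ioi 0) := fun τ hτ => by
      have : 0 < τ := hτ
      simp only [mem_Ioi]; positivity
    have hc : ContinuousOn (fun τ => G τ 1 1 - ε (1 / τ) - n (1 / τ) + κ * 2 * (1 / τ)) (Ioi 0) := by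
      refine (((continuousOn_section hG continuousOn_id continuousOn_const continuousOn_const
        ?_ ?_ ?_).sub (hε.comp hi hm)).sub (hn.comp hi hm)).add (continuousOn_const.mul hi) <;>
        intro t ht <;> simp [ht]
    refine hc.congr fun τ hτ => ?_
    have := hS τ 1 1 hτ one_pos one_pos
    simp only [one_mul] at this
    beta_reduce
    rw [this]
    ring
  have hlogc : ContinuousOn Real.log (Ioi 0) :=
    Real.continuousOn_log.mono fun x hx => (ne_of_gt hx)
  -- Taking s = 1/(x+y) and s + r = 1/x turns the three time factors into g(x), g(y), g(x+y). Since
  -- r = y/(x(x+y)), the logarithms left by -α log(s+r) and by ε are absorbed by (β-α)/2 · log up to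
  -- a multiple of log r.
  obtain ⟨d, hd⟩ := exists_affine_of_cocycle (f := fun τ => g τ - (β - α) / 2 * Real.log τ)
    (hg.sub (continuousOn_const.mul hlogc)) (by
      have key : ∀ x y, 0 < x → 0 < y → invertedLog α G 1 (1 / (x + y))
            (1 / (x + y) + (1 / x - 1 / (x + y))) 1 1 =
          g x - (β - α) / 2 * Real.log x + (g y - (β - α) / 2 * Real.log y) -
            (g (x + y) - (β - α) / 2 * Real.log (x + y)) + (ε 1 - (α + β) / 2 *
              Real.log (1 / x - 1 / (x + y)) +
              n (1 / (1 / x - 1 / (x + y))) -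
              κ * ((1 / x - 1 / (x + y)) + 2 / (1 / x - 1 / (x + y)))) := by
        intro x y hx hy
        have hr := one_div_sub_one_div_add_pos hx hy
        rw [invertedLog_of_split hS one_pos (by positivity) hr one_pos one_pos,
          add_sub_cancel, one_div_one_div, one_div_one_div, add_sub_cancel_left,
          hβ (1 * (1 / x) / _) (by positivity), one_mul (1 / x),
          Real.log_div (by positivity) hr.ne', Real.log_div one_ne_zero hx.ne', Real.log_one]
        have hl : Real.log (1 / x - 1 / (x + y)) =
            Real.log y - Real.log x - Real.log (x + y) := by
          rw [← Real.log_div hy.ne' hx.ne', ← Real.log_div (by positivity) (by positivity)]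
          congr 1
          field_simp
          ring
        rw [hl]
        ring_nf
      intro x y x' y' hx hy hx' hy' hR
      have e := h 1 (1 / (x + y)) (1 / (x' + y')) _ 1 1 one_pos (by positivity) (by positivity)
        (one_div_sub_one_div_add_pos hx hy) one_pos one_pos
      rw [key x y hx hy, hR, key x' y' hx' hy'] at e
      linarith)
  refine ⟨fun z => n z + ε 1 + g 1 - d, u, β, κ, -d, fun τ x y hτ hx hy => ?_⟩
  have e := hd τ hτ
  simp only [Real.log_one, mul_zero, sub_zero] at e
  rw [hS τ x y hτ hx hy, hβ (y / τ) (by positivity), Real.log_div hy.ne' hτ.ne']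
  linear_combination e

/-! ### Inverted densities of h-transformed models -/

theorem invertedLog_of_form {α β κ ν : ℝ} {G : ℝ → ℝ → ℝ → ℝ} {n u : ℝ → ℝ}
    (hG : ∀ τ x y, 0 < τ → 0 < x → 0 < y →
      G τ x y = n (x * y / τ) - ν * τ - (α + β) / 2 * Real.log τ + β * Real.log y + u x - u y -
        κ * (x ^ 2 + y ^ 2) / τ)
    {x s r a b : ℝ} (hx : 0 < x) (hs : 0 < s) (hr : 0 < r) (ha : 0 < a) (hb : 0 < b) :
    invertedLog α G x s (s + r) a b =
      n (x * b) - n (x * a) + n (a * b / r) - (α + β) / 2 * Real.log r + β * Real.log b -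
        κ * (x ^ 2 * r + (a ^ 2 + b ^ 2) / r) := by
  have hG' : ∀ τ x y, 0 < τ → 0 < x → 0 < y →
      G τ x y = (-ν * τ + (β - α) / 2 * Real.log τ) + β * Real.log (y / τ) + n (x * y / τ) + u x -
        u y - κ * (x ^ 2 + y ^ 2) / τ := by
    intro τ x y hτ hx hy
    rw [hG τ x y hτ hx hy, Real.log_div hy.ne' hτ.ne']
    ring
  have hσ : 1 / s - 1 / (s + r) = r / (s * (s + r)) := by field_simp; ring
  rw [invertedLog_of_split (g := fun τ => -ν * τ + (β - α) / 2 * Real.log τ)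
    (ε := fun y => β * Real.log y) hG' hx hs hr ha hb, hσ,
    Real.log_div hr.ne' (by positivity), Real.log_mul hs.ne' (by positivity),
    Real.log_div (by positivity) hr.ne', Real.log_mul ha.ne' (by positivity),
    Real.log_div one_ne_zero (by positivity), Real.log_div one_ne_zero hs.ne', Real.log_one]
  have : ν * (1 / (s + r)) + ν * (r / (s * (s + r))) - ν * (1 / s) = 0 := by field_simp; ring
  linear_combination -this

theorem invertedDensity_pos {α : ℝ} {p : ℝ → ℝ → ℝ → ℝ}
    (hpos : ∀ t x y, 0 < t → 0 < x → 0 < y → 0 < p t x y) {x s t a b : ℝ} (hx : 0 < x)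
    (hs : 0 < s) (hst : s < t) (ha : 0 < a) (hb : 0 < b) : 0 < invertedDensity α p x s t a b := by
  have ht : 0 < t := hs.trans hst
  have hσ : 0 < 1 / s - 1 / t := sub_pos.2 (one_div_lt_one_div_of_lt hs hst)
  have h1 := hpos (1 / t) x (b / t ^ α) (by positivity) hx (by positivity)
  have h2 := hpos _ (b / t ^ α) (a / s ^ α) hσ (by positivity) (by positivity)
  have h3 := hpos (1 / s) x (a / s ^ α) (by positivity) hx (by positivity)
  unfold invertedDensity
  positivity

theorem log_invertedDensity {α : ℝ} {p : ℝ → ℝ → ℝ → ℝ}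
    (hpos : ∀ t x y, 0 < t → 0 < x → 0 < y → 0 < p t x y) {x s t a b : ℝ} (hx : 0 < x)
    (hs : 0 < s) (hst : s < t) (ha : 0 < a) (hb : 0 < b) :
    Real.log (invertedDensity α p (x ^ α) s t (a ^ α) (b ^ α)) =
      invertedLog α (fun τ x y => Real.log (p τ (x ^ α) (y ^ α))) x s t a b := by
  have ht : 0 < t := hs.trans hst
  have hσ : 0 < 1 / s - 1 / t := sub_pos.2 (one_div_lt_one_div_of_lt hs hst)
  have h1 := hpos (1 / t) (x ^ α) (b ^ α / t ^ α) (by positivity) (by positivity) (by positivity)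
  have h2 := hpos _ (b ^ α / t ^ α) (a ^ α / s ^ α) hσ (by positivity) (by positivity)
  have h3 := hpos (1 / s) (x ^ α) (a ^ α / s ^ α) (by positivity) (by positivity) (by positivity)
  have h4 : 0 < t ^ (-α) := by positivity
  simp only [invertedDensity, invertedLog]
  rw [Real.div_rpow hb.le ht.le, Real.div_rpow ha.le hs.le,
    Real.log_div (by positivity) h3.ne', Real.log_mul h4.ne' (by positivity),
    Real.log_mul h1.ne' h2.ne', Real.log_rpow ht]
  ring

theorem rpow_one_div_rpow {x α : ℝ} (hx : 0 < x) (hα : 0 < α) : (x ^ (1 / α)) ^ α = x := by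
  rw [← Real.rpow_mul hx.le, one_div_mul_cancel hα.ne', Real.rpow_one]

theorem rpow_rpow_two_div {x α : ℝ} (hx : 0 < x) (hα : 0 < α) : (x ^ α) ^ (2 / α) = x ^ 2 := by
  rw [← Real.rpow_mul hx.le, mul_div_cancel₀ _ hα.ne', Real.rpow_ofNat]

/-- The logarithm of a product of the shape of `modelDensity`, in the variables `x ^ (1 / α)`. -/
theorem log_transformed_model {α β κ ν : ℝ} (hα : 0 < α) {φ h : ℝ → ℝ}
    (hφ : ∀ z, 0 < z → 0 < φ z) (hh : ∀ x, 0 < x → 0 < h x) {τ x y : ℝ} (hτ : 0 < τ)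
    (hx : 0 < x) (hy : 0 < y) :
    Real.log (h (y ^ α) / h (x ^ α) * Real.exp (-ν * τ) *
        (τ ^ (-(α / 2 * (1 + β))) * φ (x ^ α * y ^ α / τ ^ α) * (y ^ α) ^ β *
          Real.exp (-κ * ((x ^ α) ^ (2 / α) / τ + (y ^ α) ^ (2 / α) / τ)))) =
      Real.log (φ ((x * y / τ) ^ α)) - ν * τ - (α + α * β) / 2 * Real.log τ +
        α * β * Real.log y + -Real.log (h (x ^ α)) - -Real.log (h (y ^ α)) -
        κ * (x ^ 2 + y ^ 2) / τ := by
  have hyα : 0 < y ^ α := by positivity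
  have hxα : 0 < x ^ α := by positivity
  have h1 := hh _ hyα
  have h2 := hh _ hxα
  have h3 : 0 < φ (x ^ α * y ^ α / τ ^ α) := hφ _ (by positivity)
  have h4 : 0 < τ ^ (-(α / 2 * (1 + β))) := by positivity
  have h5 : 0 < (y ^ α) ^ β := by positivity
  have e : (x * y / τ) ^ α = x ^ α * y ^ α / τ ^ α := by
    rw [Real.div_rpow (by positivity) hτ.le, Real.mul_rpow hx.le hy.le]
  rw [e, rpow_rpow_two_div hx hα, rpow_rpow_two_div hy hα, Real.log_mul (by positivity)
    (by positivity), Real.log_mul (by positivity) (by positivity),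
    Real.log_mul (by positivity) (by positivity), Real.log_mul (by positivity) (by positivity),
    Real.log_mul (by positivity) (by positivity), Real.log_div h1.ne' h2.ne', Real.log_exp,
    Real.log_exp, Real.log_rpow hτ, Real.log_rpow hyα, Real.log_rpow hy]
  ring

/-- At time 1 and endpoint 1 the argument of `φ` is the starting point, and every other factor of
the density is positive. -/
theorem IsHTransform.model_pos {α β k : ℝ} {φ : ℝ → ℝ} {p : ℝ → ℝ → ℝ → ℝ}
    (hpos : ∀ t x y, 0 < t → 0 < x → 0 < y → 0 < p t x y)
    (hp : IsHTransform p (modelDensity α β k φ)) {z : ℝ} (hz : 0 < z) : 0 < φ z := by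
  obtain ⟨h, ν, hh, hp⟩ := hp
  have h1 := hpos 1 z 1 one_pos hz one_pos
  have h2 := hh z hz
  have h3 := hh 1 one_pos
  rw [hp 1 z 1 one_pos hz one_pos, modelDensity] at h1
  simp only [Real.one_rpow, mul_one, div_one, one_mul] at h1
  exact pos_of_mul_pos_left (pos_of_mul_pos_right h1 (by positivity)) (by positivity)

/-- The inverted density of an `h`-transform of a model density. -/
theorem IsHTransform.invertedDensity_eq {α β k : ℝ} (hα : 0 < α) {φ : ℝ → ℝ}
    {p : ℝ → ℝ → ℝ → ℝ} (hpos : ∀ t x y, 0 < t → 0 < x → 0 < y → 0 < p t x y)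
    (hp : IsHTransform p (modelDensity α β k φ)) {x s t a b : ℝ} (hx : 0 < x) (hs : 0 < s)
    (hst : s < t) (ha : 0 < a) (hb : 0 < b) :
    invertedDensity α p x s t a b =
      φ (x * b) / φ (x * a) * Real.exp (-(t - s) * (k ^ 2 / 2) * x ^ (2 / α)) *
        modelDensity α β k φ (t - s) a b := by
  have hφ : ∀ z, 0 < z → 0 < φ z := fun z hz => hp.model_pos hpos hz
  obtain ⟨h, ν, hh, hp⟩ := hp
  obtain ⟨r, rfl⟩ : ∃ r, t = s + r := ⟨t - s, by ring⟩
  have hr : 0 < r := by linarith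
  obtain ⟨x, hx, rfl⟩ : ∃ z : ℝ, 0 < z ∧ x = z ^ α :=
    ⟨x ^ (1 / α), by positivity, (rpow_one_div_rpow hx hα).symm⟩
  obtain ⟨a, ha, rfl⟩ : ∃ z : ℝ, 0 < z ∧ a = z ^ α :=
    ⟨a ^ (1 / α), by positivity, (rpow_one_div_rpow ha hα).symm⟩
  obtain ⟨b, hb, rfl⟩ : ∃ z : ℝ, 0 < z ∧ b = z ^ α :=
    ⟨b ^ (1 / α), by positivity, (rpow_one_div_rpow hb hα).symm⟩
  have hform : ∀ τ x y, 0 < τ → 0 < x → 0 < y → Real.log (p τ (x ^ α) (y ^ α)) =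
      Real.log (φ ((x * y / τ) ^ α)) - ν * τ - (α + α * β) / 2 * Real.log τ +
        α * β * Real.log y + -Real.log (h (x ^ α)) - -Real.log (h (y ^ α)) -
        k ^ 2 / 2 * (x ^ 2 + y ^ 2) / τ := by
    intro τ x y hτ hx hy
    rw [hp _ _ _ hτ (by positivity) (by positivity), modelDensity]
    exact log_transformed_model hα hφ hh hτ hx hy
  have h1 : 0 < φ (x ^ α * b ^ α) := hφ _ (by positivity)
  have h2 : 0 < φ (x ^ α * a ^ α) := hφ _ (by positivity)
  have h3 : 0 < φ (a ^ α * b ^ α / r ^ α) := hφ _ (by positivity)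
  have h4 : 0 < r ^ (-(α / 2 * (1 + β))) := by positivity
  have h5 : 0 < (b ^ α) ^ β := by positivity
  have hbα : 0 < b ^ α := by positivity
  rw [add_sub_cancel_left, modelDensity]
  -- Both sides are positive, so it suffices to compare logarithms, where `invertedLog_of_form` has
  -- already eliminated `h`, `ν` and `s`.
  refine Real.log_injOn_pos (invertedDensity_pos hpos hx hs hst ha hb)
    (mem_Ioi.2 (by positivity)) ?_
  rw [log_invertedDensity hpos ‹0 < x› hs hst ‹0 < a› ‹0 < b›,
    invertedLog_of_form (n := fun z => Real.log (φ (z ^ α)))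
      (u := fun x => -Real.log (h (x ^ α))) hform ‹0 < x› hs hr ‹0 < a› ‹0 < b›]
  rw [rpow_rpow_two_div ‹0 < x› hα, rpow_rpow_two_div ‹0 < a› hα, rpow_rpow_two_div ‹0 < b› hα,
    Real.log_mul (by positivity)
    (by positivity), Real.log_mul (by positivity) (by positivity),
    Real.log_mul (by positivity) (by positivity), Real.log_mul (by positivity) (by positivity),
    Real.log_mul (by positivity) (by positivity), Real.log_div h1.ne' h2.ne', Real.log_exp,
    Real.log_exp, Real.log_rpow hr, Real.log_rpow hbα, Real.log_rpow ‹0 < b›,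
    Real.mul_rpow ‹0 < x›.le ‹0 < b›.le, Real.mul_rpow ‹0 < x›.le ‹0 < a›.le,
    Real.div_rpow (by positivity) hr.le, Real.mul_rpow ‹0 < a›.le ‹0 < b›.le]
  ring

/-! ### From stationarity to the model density -/

theorem TwiceDifferentiable.continuousOn {p : ℝ → ℝ → ℝ → ℝ} (hdiff : TwiceDifferentiable p) :
    ContinuousOn (fun z : ℝ × ℝ × ℝ => p z.1 z.2.1 z.2.2) (Ioi 0 ×ˢ Ioi 0 ×ˢ Ioi 0) :=
  hdiff.1.continuousOn

/-- A density whose inverted density is stationary is an `h`-transform of a model density, up to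
the sign of the constant in the exponential. -/
theorem exists_transformed_model {α : ℝ} (hα : 0 < α) {p : ℝ → ℝ → ℝ → ℝ}
    (hpos : ∀ t x y, 0 < t → 0 < x → 0 < y → 0 < p t x y) (hdiff : TwiceDifferentiable p)
    (hst : ∀ x s s' r a b, 0 < x → 0 < s → 0 < s' → 0 < r → 0 < a → 0 < b →
      invertedDensity α p x s (s + r) a b = invertedDensity α p x s' (s' + r) a b) :
    ∃ (φ h : ℝ → ℝ) (β κ ν : ℝ), (∀ z, 0 < z → 0 < φ z) ∧ (∀ x, 0 < x → 0 < h x) ∧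
      ∀ t x y, 0 < t → 0 < x → 0 < y → p t x y = h y / h x * Real.exp (-ν * t) *
        (t ^ (-(α / 2 * (1 + β))) * φ (x * y / t ^ α) * y ^ β *
          Real.exp (-κ * (x ^ (2 / α) / t + y ^ (2 / α) / t))) := by
  have hmaps : ∀ z : ℝ × ℝ × ℝ, z ∈ (Ioi 0 ×ˢ Ioi 0 ×ˢ Ioi 0 : Set (ℝ × ℝ × ℝ)) →
      (z.1, z.2.1 ^ α, z.2.2 ^ α) ∈ (Ioi 0 ×ˢ Ioi 0 ×ˢ Ioi 0 : Set (ℝ × ℝ × ℝ)) := by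
    rintro ⟨t, x, y⟩ ⟨ht, hx, hy⟩
    exact ⟨ht, Real.rpow_pos_of_pos hx α, Real.rpow_pos_of_pos hy α⟩
  have hcα : Continuous fun z : ℝ => z ^ α := Real.continuous_rpow_const hα.le
  have hG : ContinuousOn (fun z : ℝ × ℝ × ℝ => Real.log (p z.1 (z.2.1 ^ α) (z.2.2 ^ α)))
      (Ioi 0 ×ˢ Ioi 0 ×ˢ Ioi 0) := by
    refine ContinuousOn.log (hdiff.continuousOn.comp
      (f := fun z : ℝ × ℝ × ℝ => (z.1, z.2.1 ^ α, z.2.2 ^ α)) (Continuous.continuousOn ?_)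
      hmaps) fun z hz => ?_
    · fun_prop
    · obtain ⟨h1, h2, h3⟩ := hmaps z hz
      exact (hpos _ _ _ h1 h2 h3).ne'
  have hstat : IsStationary α (fun τ x y => Real.log (p τ (x ^ α) (y ^ α))) := by
    intro x s s' r a b hx hs hs' hr ha hb
    rw [← log_invertedDensity hpos hx hs (by linarith) ha hb,
      ← log_invertedDensity hpos hx hs' (by linarith) ha hb,
      hst _ s s' r _ _ (by positivity) hs hs' hr (by positivity) (by positivity)]
  let f : ℝ × ℝ × ℝ → ℝ := fun z => p z.1 z.2.1 z.2.2
  have hopen : IsOpen (Ioi 0 ×ˢ Ioi 0 ×ˢ Ioi 0 : Set (ℝ × ℝ × ℝ)) :=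
    isOpen_Ioi.prod (isOpen_Ioi.prod isOpen_Ioi)
  have hG' : ∀ x, 0 < x → HasDerivAt (fun y => Real.log (p 1 (x ^ α) (y ^ α)))
      (fderiv ℝ f (1, x ^ α, 1) (0, 0, α) / p 1 (x ^ α) 1) 1 := by
    intro x hx
    have hxα : 0 < x ^ α := by positivity
    have hmem : ((1, x ^ α, 1) : ℝ × ℝ × ℝ) ∈
        (Ioi 0 ×ˢ Ioi 0 ×ˢ Ioi 0 : Set (ℝ × ℝ × ℝ)) :=
      ⟨mem_Ioi.2 one_pos, hxα, mem_Ioi.2 one_pos⟩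
    have h1 : HasFDerivAt f (fderiv ℝ f (1, x ^ α, 1)) (1, x ^ α, 1) :=
      (hdiff.1.differentiableAt (hopen.mem_nhds hmem)).hasFDerivAt
    have h2 : HasDerivAt (fun y : ℝ => ((1, x ^ α, y ^ α) : ℝ × ℝ × ℝ)) (0, 0, α) 1 := by
      have h3 : HasDerivAt (fun y : ℝ => y ^ α) α 1 := by
        simpa using Real.hasDerivAt_rpow_const (x := 1) (p := α) (Or.inl one_ne_zero)
      exact (hasDerivAt_const _ _).prodMk ((hasDerivAt_const _ _).prodMk h3)
    have h4 : HasFDerivAt f (fderiv ℝ f (1, x ^ α, 1)) (1, x ^ α, (1 : ℝ) ^ α) := by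
      rwa [Real.one_rpow]
    have h5 := (h4.comp_hasDerivAt (1 : ℝ) h2).log
      (by simpa [f] using (hpos 1 _ 1 one_pos hxα one_pos).ne')
    simpa [f, Function.comp_def] using h5
  -- The second order of differentiability enters only here, through continuity of the first
  -- derivative.
  have hcont : ContinuousOn
      (fun x => fderiv ℝ f (1, x ^ α, 1) (0, 0, α) / p 1 (x ^ α) 1) (Ioi 0) := by
    have hc : ContinuousOn (fun x : ℝ => ((1, x ^ α, 1) : ℝ × ℝ × ℝ)) (Ioi 0) :=
      Continuous.continuousOn (by fun_prop)
    have hm : MapsTo (fun x : ℝ => ((1, x ^ α, 1) : ℝ × ℝ × ℝ)) (Ioi 0)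
        (Ioi 0 ×ˢ Ioi 0 ×ˢ Ioi 0) := fun x hx =>
      ⟨mem_Ioi.2 one_pos, Real.rpow_pos_of_pos hx α, mem_Ioi.2 one_pos⟩
    refine ContinuousOn.div ((hdiff.2.continuousOn.comp hc hm).clm_apply continuousOn_const)
      (hdiff.continuousOn.comp hc hm) fun x hx => ?_
    obtain ⟨h1, h2, h3⟩ := hm hx
    exact (hpos _ _ _ h1 h2 h3).ne'
  obtain ⟨n, u, β, κ, ν, hform⟩ := hstat.exists_form hG hG' hcont
  -- Undoing the substitution x ↦ x^α: β log y becomes (β/α) log(y^α), so the exponent of the model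
  -- is β/α.
  refine ⟨fun z => Real.exp (n (z ^ (1 / α))), fun x => Real.exp (-u (x ^ (1 / α))), β / α, κ, ν,
    fun z _ => Real.exp_pos _, fun x _ => Real.exp_pos _, fun t x y ht hx hy => ?_⟩
  obtain ⟨x, hx, rfl⟩ : ∃ z : ℝ, 0 < z ∧ x = z ^ α :=
    ⟨x ^ (1 / α), by positivity, (rpow_one_div_rpow hx hα).symm⟩
  obtain ⟨y, hy, rfl⟩ : ∃ z : ℝ, 0 < z ∧ y = z ^ α :=
    ⟨y ^ (1 / α), by positivity, (rpow_one_div_rpow hy hα).symm⟩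
  have hinv : ∀ z : ℝ, 0 < z → (z ^ α) ^ (1 / α) = z := fun z hz => by
    rw [← Real.rpow_mul hz.le, mul_one_div_cancel hα.ne', Real.rpow_one]
  refine Real.log_injOn_pos (hpos _ _ _ ht ‹_› ‹_›) (mem_Ioi.2 (by positivity)) ?_
  rw [log_transformed_model (φ := fun z => Real.exp (n (z ^ (1 / α))))
    (h := fun x => Real.exp (-u (x ^ (1 / α)))) hα (fun z _ => Real.exp_pos _)
    (fun z _ => Real.exp_pos _) ht ‹0 < x› ‹0 < y›, hform t x y ht ‹_› ‹_›, Real.log_exp,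
    Real.log_exp, Real.log_exp, hinv _ ‹0 < x›, hinv _ ‹0 < y›, hinv _ (by positivity),
    mul_div_cancel₀ _ hα.ne']
  ring

/-! ### The Markov property for functions -/

/-- The density `p r a y`, replaced by `0` unless `a` and `y` are positive. -/
noncomputable def posDensity (p : ℝ → ℝ → ℝ → ℝ) (r a y : ℝ) : ℝ≥0∞ :=
  (Ioi 0 ×ˢ Ioi 0 : Set (ℝ × ℝ)).indicator (fun z => ENNReal.ofReal (p r z.1 z.2)) (a, y)

/-- The function `f` on the real line, extended by `0` to the cemetery. -/
abbrev onAlive (f : ℝ → ℝ≥0∞) : State → ℝ≥0∞ := Sum.elim f (fun _ => 0)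

@[simp]
theorem onAlive_inl (f : ℝ → ℝ≥0∞) (a : ℝ) : onAlive f (Sum.inl a) = f a := rfl

@[simp]
theorem onAlive_inr (f : ℝ → ℝ≥0∞) (b : Unit) : onAlive f (Sum.inr b) = 0 := rfl

theorem measurable_onAlive {f : ℝ → ℝ≥0∞} (hf : Measurable f) : Measurable (onAlive f) :=
  hf.sumElim measurable_const

theorem measurable_onAlive_comp {Ω : Type*} [MeasurableSpace Ω] {Z : Ω → State}
    (hZ : Measurable Z) {f : ℝ → ℝ≥0∞} (hf : Measurable f) :
    Measurable fun ω => onAlive f (Z ω) :=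
  (measurable_onAlive hf).comp hZ

theorem posDensity_of_pos (p : ℝ → ℝ → ℝ → ℝ) {r a y : ℝ} (ha : 0 < a) (hy : 0 < y) :
    posDensity p r a y = ENNReal.ofReal (p r a y) :=
  indicator_of_mem (show (a, y) ∈ (Ioi 0 ×ˢ Ioi 0 : Set (ℝ × ℝ)) from ⟨ha, hy⟩) _

theorem posDensity_of_nonpos (p : ℝ → ℝ → ℝ → ℝ) {r a y : ℝ} (hy : y ≤ 0) :
    posDensity p r a y = 0 :=
  indicator_of_notMem (fun h : (a, y) ∈ (Ioi 0 ×ˢ Ioi 0 : Set (ℝ × ℝ)) => not_lt.2 hy h.2) _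

theorem measurable_posDensity {p : ℝ → ℝ → ℝ → ℝ}
    (hp : ContinuousOn (fun z : ℝ × ℝ × ℝ => p z.1 z.2.1 z.2.2) (Ioi 0 ×ˢ Ioi 0 ×ˢ Ioi 0))
    {r : ℝ} (hr : 0 < r) : Measurable fun z : ℝ × ℝ => posDensity p r z.1 z.2 := by
  have hc : ContinuousOn (fun z : ℝ × ℝ => ENNReal.ofReal (p r z.1 z.2)) (Ioi 0 ×ˢ Ioi 0) :=
    ENNReal.continuous_ofReal.comp_continuousOn
      (hp.comp (f := fun z : ℝ × ℝ => (r, z.1, z.2)) (by fun_prop) fun z hz => ⟨hr, hz.1, hz.2⟩)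
  have hm : MeasurableSet (Ioi 0 ×ˢ Ioi 0 : Set (ℝ × ℝ)) := measurableSet_Ioi.prod measurableSet_Ioi
  classical
  have h : Measurable ((Ioi 0 ×ˢ Ioi 0 : Set (ℝ × ℝ)).piecewise
      (fun z => ENNReal.ofReal (p r z.1 z.2)) 0) := hc.measurable_piecewise continuousOn_const hm
  rw [piecewise_eq_indicator] at h
  exact h

theorem densityMass_eq {p : ℝ → ℝ → ℝ → ℝ} {r a : ℝ} (ha : 0 < a) (C : Set ℝ) :
    densityMass (p r a) C = ∫⁻ y in C, posDensity p r a y := by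
  rw [densityMass, inter_comm, ← Measure.restrict_restrict measurableSet_Ioi,
    ← lintegral_indicator measurableSet_Ioi]
  refine lintegral_congr fun y => ?_
  by_cases hy : 0 < y
  · rw [indicator_of_mem (mem_Ioi.2 hy), posDensity_of_pos p ha hy]
  · rw [indicator_of_notMem (by simpa using hy), posDensity_of_nonpos p (not_lt.1 hy)]

section Events

variable {Ω : Type*}

theorem measurableSet_isIn {m : MeasurableSpace Ω} {Y : ℝ → Ω → State} {t : ℝ}
    (hY : Measurable[m] (Y t)) {C : Set ℝ} (hC : MeasurableSet C) : MeasurableSet[m] (isIn Y t C) :=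
  hY hC.inl_image

theorem measurable_past {T : Set ℝ} {Y : ℝ → Ω → State} {s u : ℝ} (hu : u ∈ T) (hus : u ≤ s) :
    Measurable[past T Y s] (Y u) := by
  have h : MeasurableSpace.comap (Y u) inferInstance ≤ past T Y s :=
    le_iSup₂_of_le (f := fun u (_ : u ∈ T ∩ Iic s) => MeasurableSpace.comap (Y u) inferInstance)
      u ⟨hu, hus⟩ le_rfl
  exact fun D hD => h _ ⟨D, hD, rfl⟩

theorem past_mono {T : Set ℝ} {Y : ℝ → Ω → State} {s t : ℝ} (hst : s ≤ t) :
    past T Y s ≤ past T Y t :=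
  iSup₂_le fun _ hu => le_iSup₂_of_le
    (f := fun u (_ : u ∈ T ∩ Iic t) => MeasurableSpace.comap (Y u) inferInstance)
    _ ⟨hu.1, le_trans hu.2 hst⟩ le_rfl

theorem isIn_inter (Y : ℝ → Ω → State) (t : ℝ) (C D : Set ℝ) :
    isIn Y t C ∩ isIn Y t D = isIn Y t (C ∩ D) := by
  rw [isIn, isIn, isIn, image_inter Sum.inl_injective, preimage_inter]

theorem indicator_isIn (Y : ℝ → Ω → State) (t : ℝ) (C : Set ℝ) (f : ℝ → ℝ≥0∞) (ω : Ω) :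
    (isIn Y t C).indicator (fun ω => onAlive f (Y t ω)) ω = onAlive (C.indicator f) (Y t ω) := by
  classical
  rw [indicator_apply]
  have : ω ∈ isIn Y t C ↔ Y t ω ∈ Sum.inl '' C := Iff.rfl
  rw [this]
  rcases Y t ω with a | b
  · by_cases ha : a ∈ C <;> simp [ha]
  · simp

end Events

section Paths

variable {Ω : Type*} [mΩ : MeasurableSpace Ω] {p : ℝ → ℝ → ℝ → ℝ} {P : ℝ → Measure Ω}
  {X : ℝ → Ω → State}

theorem past_le {T : Set ℝ} {Y : ℝ → Ω → State} (hY : ∀ t ∈ T, Measurable (Y t)) (s : ℝ) :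
    past T Y s ≤ mΩ :=
  iSup₂_le fun u hu => (hY u hu.1).comap_le

theorem setLIntegral_isIn {Y : ℝ → Ω → State} {t : ℝ} (hY : Measurable (Y t)) {C : Set ℝ}
    (hC : MeasurableSet C) (f : ℝ → ℝ≥0∞) (μ : Measure Ω) (A : Set Ω) :
    ∫⁻ ω in A ∩ isIn Y t C, onAlive f (Y t ω) ∂μ =
      ∫⁻ ω in A, onAlive (C.indicator f) (Y t ω) ∂μ := by
  rw [inter_comm, ← Measure.restrict_restrict (measurableSet_isIn hY hC),
    ← lintegral_indicator (measurableSet_isIn hY hC)]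
  exact lintegral_congr fun ω => indicator_isIn Y t C f ω

theorem measure_inter_isIn {Y : ℝ → Ω → State} {t : ℝ} (hY : Measurable (Y t)) {C : Set ℝ}
    (hC : MeasurableSet C) (μ : Measure Ω) (A : Set Ω) :
    μ (A ∩ isIn Y t C) = ∫⁻ ω in A, onAlive (C.indicator 1) (Y t ω) ∂μ := by
  have h1 : ∀ ω, (isIn Y t C).indicator 1 ω = onAlive (C.indicator 1) (Y t ω) := by
    classical
    intro ω
    rw [indicator_apply]
    have : ω ∈ isIn Y t C ↔ Y t ω ∈ Sum.inl '' C := Iff.rfl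
    rw [this]
    rcases Y t ω with a | b
    · by_cases ha : a ∈ C <;> simp [ha]
    · simp
  rw [← lintegral_congr h1, lintegral_indicator_one (measurableSet_isIn hY hC),
    Measure.restrict_apply (measurableSet_isIn hY hC), inter_comm]

theorem IsMarkovProcess.law (hX : IsMarkovProcess p P X) {x t : ℝ} (hx : 0 < x) (ht : 0 < t)
    {C : Set ℝ} (hC : MeasurableSet C) : P x (isIn X t C) = densityMass (p t x) C := by
  have := hX.isProbabilityMeasure x hx
  have h := hX.markov x hx 0 t le_rfl ht univ MeasurableSet.univ C hC
  rw [univ_inter, setLIntegral_univ, sub_zero] at h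
  rw [h]
  have h2 : ∀ᵐ ω ∂(P x), Sum.elim (fun a => densityMass (p t a) C) (fun _ => 0) (X 0 ω) =
      densityMass (p t x) C := by
    filter_upwards [hX.start x hx] with ω hω
    rw [hω, Sum.elim_inl]
  rw [lintegral_congr_ae h2, lintegral_const, measure_univ, mul_one]

theorem IsMarkovProcess.ae_pos (hX : IsMarkovProcess p P X) {x t : ℝ} (hx : 0 < x) (ht : 0 ≤ t) :
    ∀ᵐ ω ∂(P x), ∀ a, X t ω = Sum.inl a → 0 < a := by
  rcases ht.eq_or_lt with rfl | ht
  · filter_upwards [hX.start x hx] with ω hω a ha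
    rw [hω] at ha
    rwa [← Sum.inl_injective ha]
  · have h := hX.law hx ht (measurableSet_Iic (a := 0))
    have h0 : (Iic 0 ∩ Ioi 0 : Set ℝ) = ∅ := by
      ext y; simp
    rw [densityMass, h0, Measure.restrict_empty, lintegral_zero_measure] at h
    filter_upwards [measure_eq_zero_iff_ae_notMem.1 h] with ω hω a ha
    by_contra hn
    exact hω ⟨a, not_lt.1 hn, ha.symm⟩

/-- The Markov property for functions. -/
theorem IsMarkovProcess.setLIntegral_onAlive (hX : IsMarkovProcess p P X)
    (hp : ContinuousOn (fun z : ℝ × ℝ × ℝ => p z.1 z.2.1 z.2.2) (Ioi 0 ×ˢ Ioi 0 ×ˢ Ioi 0))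
    {x s t : ℝ} (hx : 0 < x) (hs : 0 ≤ s) (hst : s < t) {A : Set Ω}
    (hA : MeasurableSet[past (Ici 0) X s] A) {f : ℝ → ℝ≥0∞} (hf : Measurable f) :
    ∫⁻ ω in A, onAlive f (X t ω) ∂(P x) =
      ∫⁻ ω in A, onAlive (fun a => ∫⁻ y, posDensity p (t - s) a y * f y) (X s ω) ∂(P x) := by
  have hXs := hX.measurable s hs
  have hXt := hX.measurable t (hs.trans hst.le)
  have hr : 0 < t - s := by linarith
  have hpm := measurable_posDensity hp hr
  have hT : ∀ {f : ℝ → ℝ≥0∞}, Measurable f →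
      Measurable fun a => ∫⁻ y, posDensity p (t - s) a y * f y := fun hf =>
    (hpm.mul (hf.comp measurable_snd)).lintegral_prod_right'
  refine Measurable.ennreal_induction ?_ ?_ ?_ hf
  · intro c C hC
    have e1 : ∀ ω, onAlive (C.indicator fun _ => c) (X t ω) =
        c * onAlive (C.indicator 1) (X t ω) := by
      intro ω
      rcases X t ω with a | b
      · by_cases ha : a ∈ C <;> simp [ha]
      · simp
    simp_rw [e1]
    rw [lintegral_const_mul _ (measurable_onAlive_comp hXt (measurable_one.indicator hC)),
      ← measure_inter_isIn hXt hC, hX.markov x hx s t hs hst A hA C hC]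
    -- `densityMass` and `posDensity` agree only at positive states, hence almost surely along the
    -- process; the second form is measurable in the state.
    have e2 : ∀ᵐ ω ∂((P x).restrict A),
        Sum.elim (fun a => densityMass (p (t - s) a) C) (fun _ => 0) (X s ω) =
          onAlive (fun a => ∫⁻ y in C, posDensity p (t - s) a y) (X s ω) := by
      filter_upwards [ae_restrict_of_ae (hX.ae_pos hx hs)] with ω hω
      rcases h : X s ω with a | b
      · simp only [Sum.elim_inl]
        exact densityMass_eq (hω a h) C
      · simp
    rw [lintegral_congr_ae e2, ← lintegral_const_mul]
    · refine lintegral_congr fun ω => ?_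
      rcases X s ω with a | b
      · simp only [onAlive_inl]
        rw [← lintegral_indicator hC, ← lintegral_const_mul]
        · refine lintegral_congr fun y => ?_
          by_cases hy : y ∈ C <;> simp [hy, mul_comm]
        · exact (hpm.comp (measurable_const.prodMk measurable_id)).indicator hC
      · simp
    · exact measurable_onAlive_comp hXs hpm.lintegral_prod_right'
  · intro f g hfg hf hg ihf ihg
    have e1 : ∀ ω, onAlive (f + g) (X t ω) = onAlive f (X t ω) + onAlive g (X t ω) := by
      intro ω
      rcases X t ω with a | b <;> simp
    have e2 : ∀ ω, onAlive (fun a => ∫⁻ y, posDensity p (t - s) a y * (f + g) y) (X s ω) =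
        onAlive (fun a => ∫⁻ y, posDensity p (t - s) a y * f y) (X s ω) +
          onAlive (fun a => ∫⁻ y, posDensity p (t - s) a y * g y) (X s ω) := by
      intro ω
      rcases X s ω with a | b
      · simp only [onAlive_inl, Pi.add_apply, mul_add]
        exact lintegral_add_left ((hpm.comp (measurable_const.prodMk measurable_id)).mul hf) _
      · simp
    simp_rw [e1, e2]
    rw [lintegral_add_left (measurable_onAlive_comp hXt hf), ihf, ihg,
      lintegral_add_left (measurable_onAlive_comp hXs (hT hf))]
  · intro f hf hmono ih
    have e1 : ∀ ω, onAlive (fun a => ⨆ n, f n a) (X t ω) = ⨆ n, onAlive (f n) (X t ω) := by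
      intro ω
      rcases X t ω with a | b <;> simp
    have e2 : ∀ ω, onAlive (fun a => ∫⁻ y, posDensity p (t - s) a y * ⨆ n, f n y) (X s ω) =
        ⨆ n, onAlive (fun a => ∫⁻ y, posDensity p (t - s) a y * f n y) (X s ω) := by
      intro ω
      rcases X s ω with a | b
      · simp only [onAlive_inl, ENNReal.mul_iSup]
        exact lintegral_iSup
          (fun n => (hpm.comp (measurable_const.prodMk measurable_id)).mul (hf n))
          fun i j hij y => mul_le_mul_right (hmono hij y) _
      · simp
    simp_rw [e1, e2]
    rw [lintegral_iSup (fun n => measurable_onAlive_comp hXt (hf n)),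
      lintegral_iSup (fun n => measurable_onAlive_comp hXs (hT (hf n)))]
    · simp_rw [ih]
    · intro i j hij ω
      rcases h : X s ω with a | b
      · simp only [h, onAlive_inl]
        exact lintegral_mono fun y => mul_le_mul_right (hmono hij y) _
      · simp [h]
    · intro i j hij ω
      rcases h : X t ω with a | b
      · simpa only [h, onAlive_inl] using hmono hij a
      · simp [h]

/-- The law of `X t` under `P x`, for functions. -/
theorem IsMarkovProcess.lintegral_onAlive (hX : IsMarkovProcess p P X)
    (hp : ContinuousOn (fun z : ℝ × ℝ × ℝ => p z.1 z.2.1 z.2.2) (Ioi 0 ×ˢ Ioi 0 ×ˢ Ioi 0))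
    {x t : ℝ} (hx : 0 < x) (ht : 0 < t) {f : ℝ → ℝ≥0∞} (hf : Measurable f) :
    ∫⁻ ω, onAlive f (X t ω) ∂(P x) = ∫⁻ y, posDensity p t x y * f y := by
  have := hX.isProbabilityMeasure x hx
  have h := hX.setLIntegral_onAlive hp hx le_rfl ht MeasurableSet.univ hf
  rw [setLIntegral_univ, setLIntegral_univ, sub_zero] at h
  have h2 : ∀ᵐ ω ∂(P x), onAlive (fun a => ∫⁻ y, posDensity p t a y * f y) (X 0 ω) =
      ∫⁻ y, posDensity p t x y * f y := by
    filter_upwards [hX.start x hx] with ω hω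
    rw [hω, onAlive_inl]
  rw [h, lintegral_congr_ae h2, lintegral_const, measure_univ, mul_one]

end Paths

/-! ### Time reversal -/

theorem measurableEmbedding_inl : MeasurableEmbedding (Sum.inl : ℝ → State) where
  injective := Sum.inl_injective
  measurable := measurable_inl
  measurableSet_image' := fun _ hs => MeasurableSet.inl_image hs

section Events

variable {Ω : Type*} {X : ℝ → Ω → State}

/-- Finite-dimensional events after time `σ`. -/
def futureEvents (X : ℝ → Ω → State) (σ : ℝ) : Set (Set Ω) :=
  piiUnionInter (fun u => {A | ∃ C, MeasurableSet C ∧ A = isIn X u C}) (Ici σ)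

theorem isPiSystem_futureEvents (X : ℝ → Ω → State) (σ : ℝ) : IsPiSystem (futureEvents X σ) := by
  refine isPiSystem_piiUnionInter _ (fun u => ?_) _
  rintro _ ⟨C, hC, rfl⟩ _ ⟨D, hD, rfl⟩ _
  exact ⟨C ∩ D, hC.inter hD, isIn_inter X u C D⟩

/-- The cemetery is a single point, so its preimage is the complement of being alive and the events
`isIn` already generate. -/
theorem measurable_futureEvents {σ u : ℝ} (hu : σ ≤ u) :
    Measurable[MeasurableSpace.generateFrom (futureEvents X σ)] (X u) := by
  have hgen : ∀ C, MeasurableSet C →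
      MeasurableSet[MeasurableSpace.generateFrom (futureEvents X σ)] (isIn X u C) := fun C hC =>
    MeasurableSpace.measurableSet_generateFrom
      (subset_piiUnionInter (π := fun u => {A | ∃ C, MeasurableSet C ∧ A = isIn X u C})
        (mem_Ici.2 hu) ⟨C, hC, rfl⟩)
  intro D hD
  have h1 : MeasurableSet (Sum.inl ⁻¹' D : Set ℝ) := (measurableSet_sum_iff.1 hD).1
  by_cases h : Sum.inr () ∈ D
  · have : X u ⁻¹' D = isIn X u (Sum.inl ⁻¹' D) ∪ (isIn X u univ)ᶜ := by
      ext ω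
      simp only [isIn, mem_preimage, mem_union, mem_compl_iff]
      rcases X u ω with a | ⟨⟩ <;> simp [h]
    rw [this]
    exact (hgen _ h1).union (hgen _ MeasurableSet.univ).compl
  · have : X u ⁻¹' D = isIn X u (Sum.inl ⁻¹' D) := by
      ext ω
      simp only [isIn, mem_preimage]
      rcases X u ω with a | ⟨⟩ <;> simp [h]
    rw [this]
    exact hgen _ h1

end Events

section Paths

variable {Ω : Type*} [mΩ : MeasurableSpace Ω] {p : ℝ → ℝ → ℝ → ℝ} {P : ℝ → Measure Ω}
  {X : ℝ → Ω → State}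

/-- The law of `Z` on the event that `Z` is not the cemetery. -/
noncomputable def aliveLaw (μ : Measure Ω) (Z : Ω → State) : Measure ℝ :=
  (μ.map Z).comap Sum.inl

theorem aliveLaw_apply {μ : Measure Ω} {Z : Ω → State} (hZ : Measurable Z) {C : Set ℝ}
    (hC : MeasurableSet C) : aliveLaw μ Z C = μ (Z ⁻¹' (Sum.inl '' C)) := by
  rw [aliveLaw, measurableEmbedding_inl.comap_apply, Measure.map_apply hZ hC.inl_image]

theorem lintegral_aliveLaw {μ : Measure Ω} {Z : Ω → State} (hZ : Measurable Z) {f : ℝ → ℝ≥0∞}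
    (hf : Measurable f) : ∫⁻ a, f a ∂(aliveLaw μ Z) = ∫⁻ ω, onAlive f (Z ω) ∂μ := by
  have h1 : ∫⁻ a, f a ∂(aliveLaw μ Z) = ∫⁻ z, onAlive f z ∂((aliveLaw μ Z).map Sum.inl) := by
    rw [measurableEmbedding_inl.lintegral_map]
    rfl
  rw [h1, aliveLaw, measurableEmbedding_inl.map_comap, ← lintegral_map (measurable_onAlive hf) hZ,
    ← lintegral_indicator measurableSet_range_inl]
  refine lintegral_congr fun z => ?_
  rcases z with a | b
  · exact indicator_of_mem (mem_range_self a) _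
  · exact indicator_of_notMem (by simp) _

theorem setLIntegral_isIn_univ {Y : ℝ → Ω → State} {t : ℝ} (hY : Measurable (Y t))
    (f : ℝ → ℝ≥0∞) (μ : Measure Ω) (A : Set Ω) :
    ∫⁻ ω in A ∩ isIn Y t univ, onAlive f (Y t ω) ∂μ = ∫⁻ ω in A, onAlive f (Y t ω) ∂μ := by
  rw [setLIntegral_isIn hY MeasurableSet.univ, indicator_univ]

/-- The conditional probability of a finite-dimensional event of the future, given the past, is a
function of the present. -/
theorem IsMarkovProcess.exists_future (hX : IsMarkovProcess p P X)
    (hp : ContinuousOn (fun z : ℝ × ℝ × ℝ => p z.1 z.2.1 z.2.2) (Ioi 0 ×ˢ Ioi 0 ×ˢ Ioi 0))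
    {x : ℝ} (hx : 0 < x) {B : ℝ → Set ℝ} (S : Finset ℝ) (hB : ∀ u ∈ S, MeasurableSet (B u)) :
    ∀ σ, 0 ≤ σ → (∀ u ∈ S, σ ≤ u) →
    ∃ ψ : ℝ → ℝ≥0∞, Measurable ψ ∧ ∀ E, MeasurableSet[past (Ici 0) X σ] E →
      P x (E ∩ isIn X σ univ ∩ ⋂ u ∈ S, isIn X u (B u)) =
        ∫⁻ ω in E, onAlive ψ (X σ ω) ∂(P x) := by
  -- The time added is the earliest one, so the induction hypothesis is applied at that time as the
  -- new present, and one Markov step leads back to `σ`.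
  induction S using Finset.induction_on_min with
  | empty =>
    intro σ hσ _
    refine ⟨1, measurable_one, fun E hE => ?_⟩
    have h := measure_inter_isIn (hX.measurable σ hσ) MeasurableSet.univ (P x) E
    rw [indicator_univ] at h
    simpa using h
  | insert v S hv ih =>
    intro σ hσ hS
    have hσv : σ ≤ v := hS v (Finset.mem_insert_self v S)
    have hv0 : 0 ≤ v := hσ.trans hσv
    have hBv : MeasurableSet (B v) := hB v (Finset.mem_insert_self v S)
    obtain ⟨ψ, hψ, hE⟩ := ih (fun u hu => hB u (Finset.mem_insert_of_mem hu)) v hv0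
      fun u hu => (hv u hu).le
    have hXv := hX.measurable v hv0
    have hXσ := hX.measurable σ hσ
    have hmv : Measurable[past (Ici 0) X v] (X v) := measurable_past hv0 le_rfl
    have hψB : Measurable ((B v).indicator ψ) := hψ.indicator hBv
    have key : ∀ E, MeasurableSet[past (Ici 0) X σ] E →
        P x (E ∩ isIn X σ univ ∩ ⋂ u ∈ insert v S, isIn X u (B u)) =
          ∫⁻ ω in E ∩ isIn X σ univ, onAlive ((B v).indicator ψ) (X v ω) ∂(P x) := by
      intro E hEm
      have hE' : MeasurableSet[past (Ici 0) X v] (E ∩ isIn X σ univ ∩ isIn X v (B v)) :=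
        ((past_mono hσv E hEm).inter (measurableSet_isIn (measurable_past hσ hσv)
          MeasurableSet.univ)).inter (measurableSet_isIn hmv hBv)
      rw [← setLIntegral_isIn hXv hBv, ← hE _ hE', Finset.set_biInter_insert,
        inter_assoc (E ∩ isIn X σ univ) (isIn X v (B v)) (isIn X v univ), isIn_inter, inter_univ,
        inter_assoc (E ∩ isIn X σ univ) (isIn X v (B v))]
    rcases hσv.eq_or_lt with rfl | hlt
    · refine ⟨(B σ).indicator ψ, hψB, fun E hEm => ?_⟩
      rw [key E hEm, setLIntegral_isIn_univ hXσ]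
    · refine ⟨fun a => ∫⁻ y, posDensity p (v - σ) a y * (B v).indicator ψ y,
        ((measurable_posDensity hp (sub_pos.2 hlt)).mul
          (hψB.comp measurable_snd)).lintegral_prod_right', fun E hEm => ?_⟩
      rw [key E hEm, hX.setLIntegral_onAlive hp hx hσ hlt (hEm.inter (measurableSet_isIn
        (measurable_past hσ le_rfl) MeasurableSet.univ)) hψB, setLIntegral_isIn_univ hXσ]

theorem generateFrom_futureEvents_le {σ : ℝ} (hX : ∀ u, σ ≤ u → Measurable (X u)) :
    MeasurableSpace.generateFrom (futureEvents X σ) ≤ mΩ := by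
  refine MeasurableSpace.generateFrom_le ?_
  rintro _ ⟨S, hS, f, hf, rfl⟩
  refine Finset.measurableSet_biInter _ fun u hu => ?_
  obtain ⟨C, hC, h⟩ := hf u hu
  rw [h]
  exact measurableSet_isIn (hX u (hS hu)) hC

/-- The conditional probability of `X τ ∈ C` given `X σ = y`, for `τ < σ`. -/
noncomputable def reversedMass (p : ℝ → ℝ → ℝ → ℝ) (x τ σ y : ℝ) (C : Set ℝ) : ℝ≥0∞ :=
  ∫⁻ z in C, posDensity p τ x z * posDensity p (σ - τ) z y / posDensity p σ x y

theorem measurable_reversedMass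
    (hp : ContinuousOn (fun z : ℝ × ℝ × ℝ => p z.1 z.2.1 z.2.2) (Ioi 0 ×ˢ Ioi 0 ×ˢ Ioi 0))
    {x τ σ : ℝ} (hτ : 0 < τ) (hτσ : τ < σ) (C : Set ℝ) :
    Measurable fun y => reversedMass p x τ σ y C := by
  have h1 := measurable_posDensity hp hτ
  have h2 := measurable_posDensity hp (sub_pos.2 hτσ)
  have h3 := measurable_posDensity hp (hτ.trans hτσ)
  have : Measurable fun w : ℝ × ℝ =>
      posDensity p τ x w.2 * posDensity p (σ - τ) w.2 w.1 / posDensity p σ x w.1 :=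
    ((h1.comp (measurable_const.prodMk measurable_snd)).mul
      (h2.comp (measurable_snd.prodMk measurable_fst))).div
      (h3.comp (measurable_const.prodMk measurable_fst))
  exact this.lintegral_prod_right'

/-- Bayes' formula cleared of its denominator; for y ≤ 0 both sides vanish. -/
theorem posDensity_mul_reversedMass
    (hpos : ∀ t x y, 0 < t → 0 < x → 0 < y → 0 < p t x y)
    {x τ σ y : ℝ} (hx : 0 < x) (hτ : 0 < τ) (hτσ : τ < σ) (C : Set ℝ) :
    posDensity p σ x y * reversedMass p x τ σ y C =
      ∫⁻ z in C, posDensity p τ x z * posDensity p (σ - τ) z y := by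
  by_cases hy : 0 < y
  · have h0 : posDensity p σ x y ≠ 0 := by
      rw [posDensity_of_pos p hx hy]
      exact (ENNReal.ofReal_pos.2 (hpos σ x y (hτ.trans hτσ) hx hy)).ne'
    have ht : posDensity p σ x y ≠ ∞ := by
      rw [posDensity_of_pos p hx hy]
      exact ENNReal.ofReal_ne_top
    rw [reversedMass, ← lintegral_const_mul' _ _ ht]
    exact lintegral_congr fun z => ENNReal.mul_div_cancel h0 ht
  · rw [not_lt] at hy
    simp [posDensity_of_nonpos p hy]

/-- The Markov property of the reversed process. -/
theorem IsMarkovProcess.reversed (hX : IsMarkovProcess p P X)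
    (hp : ContinuousOn (fun z : ℝ × ℝ × ℝ => p z.1 z.2.1 z.2.2) (Ioi 0 ×ˢ Ioi 0 ×ˢ Ioi 0))
    (hpos : ∀ t x y, 0 < t → 0 < x → 0 < y → 0 < p t x y)
    {x τ σ : ℝ} (hx : 0 < x) (hτ : 0 < τ) (hτσ : τ < σ) {C : Set ℝ} (hC : MeasurableSet C)
    {A : Set Ω} (hA : MeasurableSet[MeasurableSpace.generateFrom (futureEvents X σ)] A) :
    P x (A ∩ isIn X σ univ ∩ isIn X τ C) =
      ∫⁻ ω in A, onAlive (fun y => reversedMass p x τ σ y C) (X σ ω) ∂(P x) := by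
  have := hX.isProbabilityMeasure x hx
  have hσ : 0 < σ := hτ.trans hτσ
  have hXτ := hX.measurable τ hτ.le
  have hXσ := hX.measurable σ hσ.le
  have hm : MeasurableSpace.generateFrom (futureEvents X σ) ≤ mΩ :=
    generateFrom_futureEvents_le fun u hu => hX.measurable u (hσ.le.trans hu)
  have hρ := measurable_reversedMass hp (x := x) hτ hτσ C
  have hE : MeasurableSet (isIn X σ univ ∩ isIn X τ C) :=
    (measurableSet_isIn hXσ MeasurableSet.univ).inter (measurableSet_isIn hXτ hC)
  let μ₁ : Measure Ω := (P x).restrict (isIn X σ univ ∩ isIn X τ C)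
  let μ₂ : Measure Ω := (P x).withDensity fun ω =>
    onAlive (fun y => reversedMass p x τ σ y C) (X σ ω)
  -- For a finite-dimensional future event with conditional probability ψ(X_σ), both measures are
  -- the double integral of p_τ(x, z) p_{σ-τ}(z, y) ψ(y) over z ∈ C and y, in the two orders of
  -- integration. Tonelli's theorem identifies them.
  have hbase : ∀ A ∈ futureEvents X σ, μ₁ A = μ₂ A := by
    intro A hA
    have hAm : MeasurableSet A := hm A (MeasurableSpace.measurableSet_generateFrom hA)
    obtain ⟨S, hS, f, hf, rfl⟩ := hA
    choose! B hB hfB using hf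
    have hS' : (⋂ u ∈ S, f u) = ⋂ u ∈ S, isIn X u (B u) := iInter₂_congr hfB
    rw [hS'] at hAm ⊢
    obtain ⟨ψ, hψ, hE⟩ := hX.exists_future hp hx S hB σ hσ.le fun u hu => hS hu
    have hlaw : aliveLaw ((P x).restrict (⋂ u ∈ S, isIn X u (B u))) (X σ) =
        (aliveLaw (P x) (X σ)).withDensity ψ := by
      refine Measure.ext fun D hD => ?_
      have h1 := hE _ (measurableSet_isIn (measurable_past hσ.le le_rfl) hD)
      have h2 := setLIntegral_isIn hXσ hD ψ (P x) univ
      rw [isIn_inter, inter_univ] at h1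
      rw [univ_inter, setLIntegral_univ] at h2
      rw [aliveLaw_apply hXσ hD, Measure.restrict_apply (hXσ hD.inl_image),
        withDensity_apply _ hD, ← lintegral_indicator hD,
        lintegral_aliveLaw hXσ (hψ.indicator hD), ← h2, ← h1]
      rfl
    have hT : Measurable fun a => ∫⁻ y, posDensity p (σ - τ) a y * ψ y :=
      ((measurable_posDensity hp (sub_pos.2 hτσ)).mul
        (hψ.comp measurable_snd)).lintegral_prod_right'
    have e1 : μ₁ (⋂ u ∈ S, isIn X u (B u)) =
        ∫⁻ z in C, ∫⁻ y, posDensity p τ x z * posDensity p (σ - τ) z y * ψ y := by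
      have h3 : μ₁ (⋂ u ∈ S, isIn X u (B u)) =
          ∫⁻ ω in isIn X τ C, onAlive ψ (X σ ω) ∂(P x) := by
        rw [← hE _ (measurableSet_isIn (measurable_past hτ.le hτσ.le) hC),
          Measure.restrict_apply hAm, inter_comm, inter_comm (isIn X σ univ)]
      rw [h3, hX.setLIntegral_onAlive hp hx hτ.le hτσ (measurableSet_isIn (measurable_past hτ.le
        le_rfl) hC) hψ, ← univ_inter (isIn X τ C), setLIntegral_isIn hXτ hC, setLIntegral_univ,
        hX.lintegral_onAlive hp hx hτ (hT.indicator hC), ← lintegral_indicator hC]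
      refine lintegral_congr fun z => ?_
      by_cases hz : z ∈ C
      · simp only [indicator_of_mem hz, mul_assoc]
        rw [lintegral_const_mul]
        exact ((measurable_posDensity hp (sub_pos.2 hτσ)).comp
          (measurable_const.prodMk measurable_id)).mul hψ
      · simp [hz]
    have e2 : μ₂ (⋂ u ∈ S, isIn X u (B u)) =
        ∫⁻ y, ∫⁻ z in C, posDensity p τ x z * posDensity p (σ - τ) z y * ψ y := by
      rw [withDensity_apply _ hAm, ← lintegral_aliveLaw hXσ hρ, hlaw,
        lintegral_withDensity_eq_lintegral_mul _ hψ hρ, lintegral_aliveLaw hXσ (hψ.mul hρ),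
        hX.lintegral_onAlive hp hx hσ (hψ.mul hρ)]
      refine lintegral_congr fun y => ?_
      rw [lintegral_mul_const, ← posDensity_mul_reversedMass hpos hx hτ hτσ C, Pi.mul_apply]
      · ring
      · exact ((measurable_posDensity hp hτ).comp (measurable_const.prodMk measurable_id)).mul
          ((measurable_posDensity hp (sub_pos.2 hτσ)).comp
            (measurable_id.prodMk measurable_const))
    rw [e1, e2]
    refine lintegral_lintegral_swap (Measurable.aemeasurable ?_)
    exact (((measurable_posDensity hp hτ).comp (measurable_const.prodMk measurable_fst)).mul
      (measurable_posDensity hp (sub_pos.2 hτσ))).mul (hψ.comp measurable_snd)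
  -- The whole space is the event with an empty set of times; equal finite total masses allow the
  -- extension from the π-system.
  have huniv : μ₁ univ = μ₂ univ :=
    hbase univ ⟨∅, by simp, fun _ => univ, by simp, by simp⟩
  have htrim : μ₁.trim hm = μ₂.trim hm := by
    have : IsFiniteMeasure (μ₁.trim hm) := isFiniteMeasure_trim hm
    refine ext_of_generate_finite _ rfl (isPiSystem_futureEvents X σ) (fun B hB => ?_) ?_
    · rw [trim_measurableSet_eq hm (MeasurableSpace.measurableSet_generateFrom hB),
        trim_measurableSet_eq hm (MeasurableSpace.measurableSet_generateFrom hB), hbase B hB]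
    · rw [trim_measurableSet_eq hm MeasurableSet.univ, trim_measurableSet_eq hm MeasurableSet.univ,
        huniv]
  have hfin : μ₁ A = μ₂ A := by
    rw [← trim_measurableSet_eq hm hA, htrim, trim_measurableSet_eq hm hA]
  rw [inter_assoc, ← Measure.restrict_apply (hm A hA), ← withDensity_apply _ (hm A hA)]
  exact hfin

end Paths

/-! ### Chapman-Kolmogorov -/

theorem continuousAt_posDensity {p : ℝ → ℝ → ℝ → ℝ}
    (hp : ContinuousOn (fun z : ℝ × ℝ × ℝ => p z.1 z.2.1 z.2.2) (Ioi 0 ×ˢ Ioi 0 ×ˢ Ioi 0))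
    {r a y : ℝ} (hr : 0 < r) (hy : 0 < y) : ContinuousAt (posDensity p r a) y := by
  by_cases ha : 0 < a
  · have hc : ContinuousOn (fun y => ENNReal.ofReal (p r a y)) (Ioi 0) :=
      ENNReal.continuous_ofReal.comp_continuousOn (continuousOn_section hp continuousOn_const
        continuousOn_const continuousOn_id (fun _ _ => hr) (fun _ _ => ha) fun _ h => h)
    refine (hc.continuousAt (Ioi_mem_nhds hy)).congr ?_
    filter_upwards [Ioi_mem_nhds hy] with z hz
    exact (posDensity_of_pos p ha hz).symm
  · have : posDensity p r a = fun _ => 0 := by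
      funext z
      exact indicator_of_notMem
        (fun h : (a, z) ∈ (Ioi 0 ×ˢ Ioi 0 : Set (ℝ × ℝ)) => ha h.1) _
    rw [this]
    exact continuousAt_const

section Paths

variable {Ω : Type*} [mΩ : MeasurableSpace Ω] {p : ℝ → ℝ → ℝ → ℝ} {P : ℝ → Measure Ω}
  {X : ℝ → Ω → State}

/-- The Chapman-Kolmogorov equation, almost everywhere. -/
theorem IsMarkovProcess.chapmanKolmogorov_ae (hX : IsMarkovProcess p P X)
    (hp : ContinuousOn (fun z : ℝ × ℝ × ℝ => p z.1 z.2.1 z.2.2) (Ioi 0 ×ˢ Ioi 0 ×ˢ Ioi 0))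
    {x s t : ℝ} (hx : 0 < x) (hs : 0 < s) (ht : 0 < t) :
    ∀ᵐ y, ∫⁻ z, posDensity p s x z * posDensity p t z y = posDensity p (s + t) x y := by
  have hst : 0 < s + t := by linarith
  have h1 := measurable_posDensity hp hs
  have h2 := measurable_posDensity hp ht
  have h3 := measurable_posDensity hp hst
  have hm1 : Measurable fun z => posDensity p s x z :=
    h1.comp (measurable_const.prodMk measurable_id)
  have hmul : Measurable fun w : ℝ × ℝ => posDensity p s x w.2 * posDensity p t w.2 w.1 :=
    (hm1.comp measurable_snd).mul (h2.comp (measurable_snd.prodMk measurable_fst))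
  refine ae_eq_of_forall_setLIntegral_eq_of_sigmaFinite hmul.lintegral_prod_right'
    (h3.comp (measurable_const.prodMk measurable_id)) fun C hC _ => ?_
  have hi : Measurable (C.indicator (1 : ℝ → ℝ≥0∞)) := measurable_one.indicator hC
  have e1 := hX.lintegral_onAlive hp hx hst hi
  have e2 := hX.setLIntegral_onAlive hp hx hs.le (show s < s + t by linarith)
    (MeasurableSet.univ (m := past (Ici 0) X s)) hi
  have hT : Measurable fun a => ∫⁻ y, posDensity p t a y * C.indicator 1 y :=
    (h2.mul (hi.comp measurable_snd)).lintegral_prod_right'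
  rw [setLIntegral_univ, setLIntegral_univ, add_sub_cancel_left, hX.lintegral_onAlive hp hx hs hT,
    e1] at e2
  have e3 : ∀ g : ℝ → ℝ≥0∞, ∫⁻ y, g y * C.indicator 1 y = ∫⁻ y in C, g y := by
    intro g
    rw [← lintegral_indicator hC]
    refine lintegral_congr fun y => ?_
    by_cases hy : y ∈ C <;> simp [hy]
  simp only [e3] at e2
  rw [lintegral_lintegral_swap hmul.aemeasurable]
  refine Eq.trans ?_ e2.symm
  refine lintegral_congr fun z => ?_
  exact lintegral_const_mul _ (h2.comp (measurable_const.prodMk measurable_id))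

/-- One half of the Chapman-Kolmogorov equation, everywhere. -/
theorem IsMarkovProcess.chapmanKolmogorov_le (hX : IsMarkovProcess p P X)
    (hp : ContinuousOn (fun z : ℝ × ℝ × ℝ => p z.1 z.2.1 z.2.2) (Ioi 0 ×ˢ Ioi 0 ×ˢ Ioi 0))
    {x s t y : ℝ} (hx : 0 < x) (hs : 0 < s) (ht : 0 < t) (hy : 0 < y) :
    ∫⁻ z, posDensity p s x z * posDensity p t z y ≤ posDensity p (s + t) x y := by
  have hst : 0 < s + t := by linarith
  -- The endpoints at which equality holds are dense. Approximating `y` by such endpoints, Fatou's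
  -- lemma and continuity of the densities give the inequality at `y`.
  have hd := Measure.dense_of_ae (hX.chapmanKolmogorov_ae hp hx hs ht)
  obtain ⟨v, hv, hvy⟩ := mem_closure_iff_seq_limit.1 (hd y)
  have hm : ∀ y, Measurable fun z => posDensity p s x z * posDensity p t z y := fun y =>
    ((measurable_posDensity hp hs).comp (measurable_const.prodMk measurable_id)).mul
      ((measurable_posDensity hp ht).comp (measurable_id.prodMk measurable_const))
  have hfin : ∀ z, posDensity p s x z ≠ ∞ := by
    intro z
    unfold posDensity
    rw [indicator_apply]
    split_ifs
    · exact ENNReal.ofReal_ne_top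
    · exact ENNReal.zero_ne_top
  calc ∫⁻ z, posDensity p s x z * posDensity p t z y
      = ∫⁻ z, Filter.liminf (fun n => posDensity p s x z * posDensity p t z (v n))
          Filter.atTop := by
        refine lintegral_congr fun z => ?_
        exact (ENNReal.Tendsto.const_mul ((continuousAt_posDensity hp ht hy).tendsto.comp hvy)
          (Or.inr (hfin z))).liminf_eq.symm
    _ ≤ Filter.liminf (fun n => ∫⁻ z, posDensity p s x z * posDensity p t z (v n))
          Filter.atTop := lintegral_liminf_le fun n => hm (v n)
    _ = Filter.liminf (fun n => posDensity p (s + t) x (v n)) Filter.atTop := by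
        congr 1
        funext n
        exact hv n
    _ = posDensity p (s + t) x y :=
        ((continuousAt_posDensity hp hst hy).tendsto.comp hvy).liminf_eq

end Paths

/-! ### The sign of the exponent -/

theorem lintegral_inv_Ioi : ∫⁻ z in Ioi (0 : ℝ), ENNReal.ofReal z⁻¹ = ∞ := by
  by_contra h
  refine not_integrableOn_Ioi_inv (a := (0 : ℝ)) ⟨by fun_prop, ?_⟩
  rw [hasFiniteIntegral_iff_norm]
  refine lt_of_le_of_lt (le_of_eq ?_) (lt_top_iff_ne_top.2 h)
  refine setLIntegral_congr_fun measurableSet_Ioi fun z hz => ?_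
  have : 0 < z := hz
  rw [Real.norm_of_nonneg (by positivity)]

/-- The Chapman-Kolmogorov inequality forces the exponent of a transformed model density to be
negative. -/
theorem pos_of_chapmanKolmogorov {α β κ ν : ℝ} (hα : 0 < α) {p : ℝ → ℝ → ℝ → ℝ} {φ h : ℝ → ℝ}
    (hφ : ∀ z, 0 < z → 0 < φ z) (hh : ∀ x, 0 < x → 0 < h x)
    (hp : ∀ t x y, 0 < t → 0 < x → 0 < y → p t x y = h y / h x * Real.exp (-ν * t) *
        (t ^ (-(α / 2 * (1 + β))) * φ (x * y / t ^ α) * y ^ β *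
          Real.exp (-κ * (x ^ (2 / α) / t + y ^ (2 / α) / t))))
    (hm : Measurable fun z => posDensity p 1 1 z * posDensity p 1 z 1)
    (hCK : ∀ x s t y, 0 < x → 0 < s → 0 < t → 0 < y →
      ∫⁻ z, posDensity p s x z * posDensity p t z y ≤ posDensity p (s + t) x y) : 0 < κ := by
  by_contra hκ
  rw [not_lt] at hκ
  set e : ℝ := α / 2 * (1 + β) with he
  let I : ℝ≥0∞ := ∫⁻ z in Ioi (0 : ℝ), ENNReal.ofReal (φ z ^ 2 * z ^ β)
  -- Chapman-Kolmogorov from x to x = (2θ)^α in two steps of length 2θ: the argument of φ is z in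
  -- each factor on the left and θ^α on the right. As κ ≤ 0, the exponentials on the left are at
  -- least the one on the right.
  have hI : ∀ θ : ℝ, 0 < θ → I ≤ ENNReal.ofReal (θ ^ e * φ (θ ^ α)) := by
    intro θ hθ
    have hx : 0 < (2 * θ) ^ α := by positivity
    have h2 : 0 < 2 * θ := by positivity
    have hck := hCK ((2 * θ) ^ α) (2 * θ) (2 * θ) ((2 * θ) ^ α) hx h2 h2 hx
    have hφθ := hφ (θ ^ α) (by positivity)
    have hhx := hh _ hx
    rw [posDensity_of_pos p hx hx] at hck
    -- the common factor of both sides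
    set K : ℝ := Real.exp (-ν * (4 * θ)) * ((2 * θ) ^ α) ^ β * Real.exp (-κ * (2 * θ)) *
      (4 * θ) ^ (-e) * θ ^ (-e) with hK
    have hK0 : 0 < K := by positivity
    have hpow : (2 * θ) ^ (-e) * (2 * θ) ^ (-e) = (4 * θ) ^ (-e) * θ ^ (-e) := by
      rw [← Real.mul_rpow h2.le h2.le, ← Real.mul_rpow (by positivity) hθ.le]
      congr 1
      ring
    have hsq : ((2 * θ) ^ α) ^ (2 / α) = (2 * θ) ^ 2 := rpow_rpow_two_div h2 hα
    have hr : p (2 * θ + 2 * θ) ((2 * θ) ^ α) ((2 * θ) ^ α) = K * (θ ^ e * φ (θ ^ α)) := by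
      rw [hp _ _ _ (by positivity) hx hx, hsq, ← Real.mul_rpow h2.le h2.le,
        ← Real.div_rpow (by positivity) (by positivity), div_self hhx.ne',
        show 2 * θ * (2 * θ) / (2 * θ + 2 * θ) = θ by field_simp; norm_num,
        show (2 * θ) ^ 2 / (2 * θ + 2 * θ) + (2 * θ) ^ 2 / (2 * θ + 2 * θ) = 2 * θ by
          field_simp, show 2 * θ + 2 * θ = 4 * θ by ring, hK]
      have : θ ^ (-e) * θ ^ e = 1 := by
        rw [← Real.rpow_add hθ, neg_add_cancel, Real.rpow_zero]
      linear_combination (-Real.exp (-ν * (4 * θ)) * ((2 * θ) ^ α) ^ β * Real.exp (-κ * (2 * θ)) *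
        (4 * θ) ^ (-e) * φ (θ ^ α)) * this
    have hl : ∀ z, 0 < z → K * (φ z ^ 2 * z ^ β) ≤
        p (2 * θ) ((2 * θ) ^ α) z * p (2 * θ) z ((2 * θ) ^ α) := by
      intro z hz
      have hhz := hh z hz
      have hφz := hφ z hz
      have hexp : Real.exp (-κ * (2 * θ)) ≤
          Real.exp (-κ * ((2 * θ) ^ 2 / (2 * θ) + z ^ (2 / α) / (2 * θ))) *
            Real.exp (-κ * (z ^ (2 / α) / (2 * θ) + (2 * θ) ^ 2 / (2 * θ))) := by
        rw [← Real.exp_add, Real.exp_le_exp]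
        have : 0 ≤ z ^ (2 / α) / (2 * θ) := by positivity
        have h4 : (2 * θ) ^ 2 / (2 * θ) = 2 * θ := by field_simp
        rw [h4]
        nlinarith
      have hν : Real.exp (-ν * (4 * θ)) = Real.exp (-ν * (2 * θ)) * Real.exp (-ν * (2 * θ)) := by
        rw [← Real.exp_add]; ring_nf
      rw [hp _ _ _ h2 hx hz, hp _ _ _ h2 hz hx, hsq, mul_div_cancel_left₀ _ hx.ne',
        mul_div_cancel_right₀ _ hx.ne', hK, hν, mul_assoc _ ((4 * θ) ^ (-e)), ← hpow]
      calc _ = (Real.exp (-ν * (2 * θ)) * Real.exp (-ν * (2 * θ)) * ((2 * θ) ^ α) ^ β *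
            ((2 * θ) ^ (-e) * (2 * θ) ^ (-e)) * (φ z ^ 2 * z ^ β)) *
            Real.exp (-κ * (2 * θ)) := by ring
        _ ≤ _ := mul_le_mul_of_nonneg_left hexp (by positivity)
        _ = _ := by field_simp
    have hKI : ENNReal.ofReal K * I ≤ ENNReal.ofReal K * ENNReal.ofReal (θ ^ e * φ (θ ^ α)) := by
      rw [← ENNReal.ofReal_mul hK0.le, ← hr]
      refine le_trans ?_ hck
      rw [← lintegral_const_mul' _ _ ENNReal.ofReal_ne_top, ← lintegral_indicator measurableSet_Ioi]
      refine lintegral_mono fun z => ?_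
      by_cases hz : 0 < z
      · rw [indicator_of_mem (mem_Ioi.2 hz), posDensity_of_pos p hx hz, posDensity_of_pos p hz hx,
          ← ENNReal.ofReal_mul hK0.le, ← ENNReal.ofReal_mul]
        · exact ENNReal.ofReal_le_ofReal (hl z hz)
        · rw [hp _ _ _ h2 hx hz]
          have := hh z hz
          have := hφ ((2 * θ) ^ α * z / (2 * θ) ^ α) (by positivity)
          positivity
      · rw [indicator_of_notMem (by simpa using hz)]
        exact zero_le
    exact (ENNReal.mul_le_mul_iff_right (ENNReal.ofReal_pos.2 hK0).ne' ENNReal.ofReal_ne_top).1 hKI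
  have hItop : I ≠ ∞ := ne_top_of_le_ne_top ENNReal.ofReal_ne_top (hI 1 one_pos)
  set i : ℝ := I.toReal with hi
  have hIi : I = ENNReal.ofReal i := (ENNReal.ofReal_toReal hItop).symm
  -- With θ = z^{1/α} the squared bound reads I² ≤ z^{1+β} φ(z)². If I were positive, the integrand
  -- of I would dominate a multiple of 1/z, against finiteness.
  have hlow : ∀ z, 0 < z → i ^ 2 * z⁻¹ ≤ φ z ^ 2 * z ^ β := by
    intro z hz
    have h1 := hI (z ^ (1 / α)) (by positivity)
    have hφz := hφ z hz
    rw [hIi, rpow_one_div_rpow hz hα, ENNReal.ofReal_le_ofReal_iff (by positivity)] at h1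
    have h2 : i ^ 2 ≤ ((z ^ (1 / α)) ^ e * φ z) ^ 2 :=
      pow_le_pow_left₀ ENNReal.toReal_nonneg h1 2
    have h3 : ((z ^ (1 / α)) ^ e) ^ 2 = z ^ β * z := by
      rw [← Real.rpow_natCast, ← Real.rpow_mul hz.le, ← Real.rpow_mul hz.le,
        ← Real.rpow_add_one hz.ne']
      congr 1
      rw [he]
      push_cast
      field_simp
      ring
    rw [mul_pow, h3] at h2
    rw [← div_eq_mul_inv, div_le_iff₀ hz]
    linarith
  have hi0 : i = 0 := by
    by_contra hne
    have hi2 : 0 < i ^ 2 := by positivity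
    refine hItop (top_le_iff.1 ?_)
    calc (∞ : ℝ≥0∞) = ENNReal.ofReal (i ^ 2) * ∫⁻ z in Ioi (0 : ℝ), ENNReal.ofReal z⁻¹ := by
          rw [lintegral_inv_Ioi, ENNReal.mul_top (ENNReal.ofReal_pos.2 hi2).ne']
      _ = ∫⁻ z in Ioi (0 : ℝ), ENNReal.ofReal (i ^ 2 * z⁻¹) := by
          rw [← lintegral_const_mul' _ _ ENNReal.ofReal_ne_top]
          simp_rw [ENNReal.ofReal_mul hi2.le]
      _ ≤ I := setLIntegral_mono' measurableSet_Ioi fun z hz =>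
          ENNReal.ofReal_le_ofReal (hlow z hz)
  have hI0 : I = 0 := by rw [hIi, hi0, ENNReal.ofReal_zero]
  -- Measurability of φ is not given; the integrand is rewritten through p_1(1, z) p_1(z, 1), from
  -- which h cancels.
  have hg : Measurable fun z => posDensity p 1 1 z * posDensity p 1 z 1 *
      ENNReal.ofReal (Real.exp (2 * ν + 2 * κ * (1 + z ^ (2 / α)))) :=
    hm.mul (by fun_prop)
  have hIg : I = ∫⁻ z in Ioi (0 : ℝ), posDensity p 1 1 z * posDensity p 1 z 1 *
      ENNReal.ofReal (Real.exp (2 * ν + 2 * κ * (1 + z ^ (2 / α)))) := by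
    refine setLIntegral_congr_fun measurableSet_Ioi fun z hz => ?_
    have hz : 0 < z := hz
    have hhz := hh z hz
    have hh1 := hh 1 one_pos
    have hφz := hφ z hz
    rw [posDensity_of_pos p one_pos hz, posDensity_of_pos p hz one_pos,
      hp _ _ _ one_pos one_pos hz, hp _ _ _ one_pos hz one_pos]
    simp only [Real.one_rpow, one_mul, mul_one, div_one]
    rw [← ENNReal.ofReal_mul (by positivity), ← ENNReal.ofReal_mul (by positivity)]
    congr 1
    have h1 : Real.exp (-ν) * Real.exp (-ν) * Real.exp (-κ * (1 + z ^ (2 / α))) *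
        Real.exp (-κ * (z ^ (2 / α) + 1)) *
        Real.exp (2 * ν + 2 * κ * (1 + z ^ (2 / α))) = 1 := by
      rw [← Real.exp_add, ← Real.exp_add, ← Real.exp_add, ← Real.exp_add, Real.exp_eq_one_iff]
      ring
    have h2 : h z / h 1 * (h 1 / h z) = 1 := by field_simp
    linear_combination (-φ z ^ 2 * z ^ β * (h z / h 1 * (h 1 / h z))) * h1 -
      φ z ^ 2 * z ^ β * h2
  have hIpos : 0 < I := by
    rw [hIg, setLIntegral_pos_iff hg]
    refine lt_of_lt_of_le (show (0 : ℝ≥0∞) < volume (Ioi (0 : ℝ)) by simp)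
      (measure_mono fun z hz => ⟨?_, hz⟩)
    have hz : 0 < z := hz
    have hhz := hh z hz
    have hh1 := hh 1 one_pos
    have hφz := hφ z hz
    rw [Function.mem_support, posDensity_of_pos p one_pos hz, posDensity_of_pos p hz one_pos,
      hp _ _ _ one_pos one_pos hz, hp _ _ _ one_pos hz one_pos]
    simp only [Real.one_rpow, one_mul, mul_one, div_one]
    rw [← ENNReal.ofReal_mul (by positivity), ← ENNReal.ofReal_mul (by positivity)]
    exact (ENNReal.ofReal_pos.2 (by positivity)).ne'
  exact hIpos.ne' hI0

/-! ### Transition densities of the inverted process -/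

theorem continuousOn_invertedDensity {α : ℝ} {p : ℝ → ℝ → ℝ → ℝ}
    (hp : ContinuousOn (fun z : ℝ × ℝ × ℝ => p z.1 z.2.1 z.2.2) (Ioi 0 ×ˢ Ioi 0 ×ˢ Ioi 0))
    (hpos : ∀ t x y, 0 < t → 0 < x → 0 < y → 0 < p t x y) {x s : ℝ} (hx : 0 < x) (hs : 0 < s) :
    ContinuousOn (fun z : ℝ × ℝ × ℝ => invertedDensity α p x s (s + z.1) z.2.1 z.2.2)
      (Ioi 0 ×ˢ Ioi 0 ×ˢ Ioi 0) := by
  have ht : ∀ z ∈ (Ioi 0 ×ˢ Ioi 0 ×ˢ Ioi 0 : Set (ℝ × ℝ × ℝ)), 0 < s + z.1 := fun z hz =>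
    add_pos hs hz.1
  have hc1 : ContinuousOn (fun z : ℝ × ℝ × ℝ => s + z.1) (Ioi 0 ×ˢ Ioi 0 ×ˢ Ioi 0) := by fun_prop
  have hpow : ∀ c : ℝ, ContinuousOn (fun z : ℝ × ℝ × ℝ => (s + z.1) ^ c)
      (Ioi 0 ×ˢ Ioi 0 ×ˢ Ioi 0) := fun c =>
    hc1.rpow_const fun z hz => Or.inl (ht z hz).ne'
  have hinv : ContinuousOn (fun z : ℝ × ℝ × ℝ => 1 / (s + z.1)) (Ioi 0 ×ˢ Ioi 0 ×ˢ Ioi 0) :=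
    continuousOn_const.div hc1 fun z hz => (ht z hz).ne'
  have hb : ContinuousOn (fun z : ℝ × ℝ × ℝ => z.2.2 / (s + z.1) ^ α)
      (Ioi 0 ×ˢ Ioi 0 ×ˢ Ioi 0) :=
    ContinuousOn.div (by fun_prop) (hpow α) fun z hz => (Real.rpow_pos_of_pos (ht z hz) α).ne'
  have ha : ContinuousOn (fun z : ℝ × ℝ × ℝ => z.2.1 / s ^ α) (Ioi 0 ×ˢ Ioi 0 ×ˢ Ioi 0) := by
    fun_prop
  have hbpos : ∀ z ∈ (Ioi 0 ×ˢ Ioi 0 ×ˢ Ioi 0 : Set (ℝ × ℝ × ℝ)), 0 < z.2.2 / (s + z.1) ^ α :=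
    fun z hz => div_pos hz.2.2 (Real.rpow_pos_of_pos (ht z hz) α)
  have hapos : ∀ z ∈ (Ioi 0 ×ˢ Ioi 0 ×ˢ Ioi 0 : Set (ℝ × ℝ × ℝ)), 0 < z.2.1 / s ^ α :=
    fun z hz => div_pos hz.2.1 (Real.rpow_pos_of_pos hs α)
  refine ContinuousOn.div ((hpow (-α)).mul (ContinuousOn.mul ?_ ?_)) ?_ ?_
  · exact hp.comp (f := fun z : ℝ × ℝ × ℝ => (1 / (s + z.1), x, z.2.2 / (s + z.1) ^ α))
      (hinv.prodMk (continuousOn_const.prodMk hb))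
      fun z hz => ⟨one_div_pos.2 (ht z hz), hx, hbpos z hz⟩
  · exact hp.comp (f := fun z : ℝ × ℝ × ℝ =>
      (1 / s - 1 / (s + z.1), z.2.2 / (s + z.1) ^ α, z.2.1 / s ^ α))
      ((continuousOn_const.sub hinv).prodMk (hb.prodMk ha))
      fun z hz => ⟨one_div_sub_one_div_add_pos hs hz.1, hbpos z hz, hapos z hz⟩
  · exact hp.comp (f := fun z : ℝ × ℝ × ℝ => (1 / s, x, z.2.1 / s ^ α))
      (continuousOn_const.prodMk (continuousOn_const.prodMk ha))
      fun z hz => ⟨one_div_pos.2 hs, hx, hapos z hz⟩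
  · exact fun z hz => (hpos _ _ _ (one_div_pos.2 hs) hx (hapos z hz)).ne'

/-- The change of variable b = t^α z; its Jacobian is the factor t^{-α} in the inverted density. -/
theorem reversedMass_eq_densityMass {α : ℝ} {p : ℝ → ℝ → ℝ → ℝ}
    (hpos : ∀ t x y, 0 < t → 0 < x → 0 < y → 0 < p t x y) {x s t y : ℝ} (hx : 0 < x)
    (hs : 0 < s) (hst : s < t) (hy : 0 < y) {C : Set ℝ} (hC : MeasurableSet C) :
    reversedMass p x (1 / t) (1 / s) y ((fun z => t ^ α * z) ⁻¹' C) =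
      densityMass (invertedDensity α p x s t (s ^ α * y)) C := by
  have ht : 0 < t := hs.trans hst
  have hc : 0 < t ^ α := by positivity
  have hsα : 0 < s ^ α := by positivity
  have hσ : 0 < 1 / s - 1 / t := sub_pos.2 (one_div_lt_one_div_of_lt hs hst)
  have hC' : MeasurableSet ((fun z => t ^ α * z) ⁻¹' C) := measurable_const_mul _ hC
  have hCI : MeasurableSet (C ∩ Ioi 0) := hC.inter measurableSet_Ioi
  let g : ℝ → ℝ≥0∞ := (C ∩ Ioi 0).indicator fun b =>
    ENNReal.ofReal (invertedDensity α p x s t (s ^ α * y) b)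
  have h1 : densityMass (invertedDensity α p x s t (s ^ α * y)) C =
      ENNReal.ofReal (t ^ α) * ∫⁻ z, g (t ^ α * z) := by
    rw [densityMass, ← lintegral_indicator hCI]
    conv_lhs => rw [← Real.smul_map_volume_mul_left hc.ne']
    rw [lintegral_smul_measure, abs_of_pos hc, smul_eq_mul]
    congr 1
    exact lintegral_map_equiv g (Homeomorph.mulLeft₀ (t ^ α) hc.ne').toMeasurableEquiv
  rw [h1, ← lintegral_const_mul' _ _ ENNReal.ofReal_ne_top, reversedMass, ← lintegral_indicator hC']
  refine lintegral_congr fun z => ?_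
  by_cases hz : 0 < z
  · by_cases hzC : t ^ α * z ∈ C
    · have hmem : t ^ α * z ∈ C ∩ Ioi 0 := ⟨hzC, mem_Ioi.2 (by positivity)⟩
      have p1 := hpos (1 / t) x z (by positivity) hx hz
      have p2 := hpos (1 / s) x y (by positivity) hx hy
      have p3 := hpos _ z y hσ hz hy
      rw [indicator_of_mem (show z ∈ (fun z => t ^ α * z) ⁻¹' C from hzC)]
      simp only [g]
      rw [indicator_of_mem hmem, posDensity_of_pos p hx hz, posDensity_of_pos p hz hy,
        posDensity_of_pos p hx hy, ← ENNReal.ofReal_mul p1.le, ← ENNReal.ofReal_div_of_pos p2,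
        ← ENNReal.ofReal_mul hc.le, invertedDensity, mul_div_cancel_left₀ _ hc.ne',
        mul_div_cancel_left₀ _ hsα.ne', Real.rpow_neg ht.le]
      congr 1
      field_simp
    · rw [indicator_of_notMem (show z ∉ (fun z => t ^ α * z) ⁻¹' C from hzC)]
      simp only [g]
      rw [indicator_of_notMem (fun h => hzC h.1), mul_zero]
  · have hz' : ¬ 0 < t ^ α * z := by
      rw [mul_pos_iff_of_pos_left hc]; exact hz
    simp only [g]
    rw [indicator_of_notMem (s := C ∩ Ioi 0) (fun h => hz' h.2), mul_zero]
    simp [posDensity_of_nonpos p (not_lt.1 hz)]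

theorem isIn_timeInverted {Ω : Type*} (α : ℝ) (X : ℝ → Ω → State) (t : ℝ) (C : Set ℝ) :
    isIn (timeInverted α X) t C = isIn X (1 / t) ((fun z => t ^ α * z) ⁻¹' C) := by
  ext ω
  simp only [isIn, mem_preimage, timeInverted]
  rcases X (1 / t) ω with a | b <;> simp

section Paths

variable {Ω : Type*} [mΩ : MeasurableSpace Ω] {α : ℝ} {p : ℝ → ℝ → ℝ → ℝ} {P : ℝ → Measure Ω}
  {X : ℝ → Ω → State}

theorem IsMarkovProcess.measurable_timeInverted (hX : IsMarkovProcess p P X) {t : ℝ} (ht : 0 < t) :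
    Measurable (timeInverted α X t) :=
  (Measurable.sumMap (measurable_const_mul (t ^ α)) measurable_id).comp
    (hX.measurable (1 / t) (by positivity))

theorem IsMarkovProcess.ae_pos_timeInverted (hX : IsMarkovProcess p P X) {x t : ℝ} (hx : 0 < x)
    (ht : 0 < t) : ∀ᵐ ω ∂(P x), ∀ a, timeInverted α X t ω = Sum.inl a → 0 < a := by
  filter_upwards [hX.ae_pos hx (show 0 ≤ 1 / t by positivity)] with ω hω a ha
  rcases h : X (1 / t) ω with y | b
  · rw [timeInverted, h, Sum.map_inl] at ha
    rw [← Sum.inl_injective ha]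
    have := hω y h
    positivity
  · rw [timeInverted, h, Sum.map_inr] at ha
    cases ha

theorem HasTransitions.congr {Y : ℝ → Ω → State} {μ : Measure Ω}
    {κ κ' : ℝ → ℝ → ℝ → Set ℝ → ℝ≥0∞} (h : HasTransitions Y μ κ)
    (heq : ∀ s t, 0 < s → s < t → ∀ C, MeasurableSet C →
      ∀ᵐ ω ∂μ, ∀ a, Y s ω = Sum.inl a → κ s t a C = κ' s t a C) : HasTransitions Y μ κ' := by
  intro s t hs hst A hA C hC
  rw [h s t hs hst A hA C hC]
  refine lintegral_congr_ae (ae_restrict_of_ae ?_)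
  filter_upwards [heq s t hs hst C hC] with ω hω
  rcases h : Y s ω with a | b
  · exact hω a h
  · rfl

/-- The time-inverted process is Markov with the inverted densities as transition densities. -/
theorem IsMarkovProcess.hasTransitions_timeInverted (hX : IsMarkovProcess p P X)
    (hp : ContinuousOn (fun z : ℝ × ℝ × ℝ => p z.1 z.2.1 z.2.2) (Ioi 0 ×ˢ Ioi 0 ×ˢ Ioi 0))
    (hpos : ∀ t x y, 0 < t → 0 < x → 0 < y → 0 < p t x y) {x : ℝ} (hx : 0 < x) :
    HasTransitions (timeInverted α X) (P x)
      (fun s t a C => densityMass (invertedDensity α p x s t a) C) := by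
  intro s t hs hst A hA C hC
  have ht : 0 < t := hs.trans hst
  -- Inversion of time sends the past up to `s` into the future of X after 1/s.
  have hA' : MeasurableSet[MeasurableSpace.generateFrom (futureEvents X (1 / s))] A := by
    refine (iSup₂_le fun u hu => ?_ : past (Ioi 0) (timeInverted α X) s ≤ _) A hA
    have hu0 : 0 < u := hu.1
    have hm : Measurable[MeasurableSpace.generateFrom (futureEvents X (1 / s))]
        (timeInverted α X u) :=
      (Measurable.sumMap (measurable_const_mul (u ^ α)) measurable_id).comp
        (measurable_futureEvents (one_div_le_one_div_of_le hu0 hu.2))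
    exact hm.comap_le
  have hC' : MeasurableSet ((fun z => t ^ α * z) ⁻¹' C) := measurable_const_mul _ hC
  rw [isIn_timeInverted, isIn_timeInverted, preimage_univ,
    hX.reversed hp hpos hx (by positivity) (one_div_lt_one_div_of_lt hs hst) hC' hA']
  refine lintegral_congr_ae (ae_restrict_of_ae ?_)
  filter_upwards [hX.ae_pos hx (show 0 ≤ 1 / s by positivity)] with ω hω
  rcases h : X (1 / s) ω with y | b
  · simp only [timeInverted, h, Sum.map_inl, Sum.elim_inl]
    exact reversedMass_eq_densityMass hpos hx hs hst (hω y h) hC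
  · simp only [timeInverted, h, Sum.map_inr, Sum.elim_inr]

/-- A property that holds almost surely for the inverted process at a given time, when alive, holds
Lebesgue almost everywhere on the half-line. -/
theorem IsMarkovProcess.ae_of_aliveLaw (hX : IsMarkovProcess p P X)
    (hp : ContinuousOn (fun z : ℝ × ℝ × ℝ => p z.1 z.2.1 z.2.2) (Ioi 0 ×ˢ Ioi 0 ×ˢ Ioi 0))
    (hpos : ∀ t x y, 0 < t → 0 < x → 0 < y → 0 < p t x y) {x s : ℝ} (hx : 0 < x) (hs : 0 < s)
    {q : ℝ → Prop} (hq : ∀ᵐ a ∂(aliveLaw (P x) (timeInverted α X s)), q a) :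
    ∀ᵐ a ∂(volume.restrict (Ioi 0)), q a := by
  -- Because `p` is positive, a set null for the law of the inverted process is Lebesgue-null on the
  -- half-line.
  suffices h : volume.restrict (Ioi (0 : ℝ)) ≪ aliveLaw (P x) (timeInverted α X s) from h hq
  refine Measure.AbsolutelyContinuous.mk fun D hD h0 => ?_
  have hc : 0 < s ^ α := by positivity
  have hσ : 0 < 1 / s := by positivity
  have hD' : MeasurableSet ((fun z => s ^ α * z) ⁻¹' D) := measurable_const_mul _ hD
  have hm : Measurable fun y => posDensity p (1 / s) x y :=
    (measurable_posDensity hp hσ).comp (measurable_const.prodMk measurable_id)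
  rw [aliveLaw_apply (hX.measurable_timeInverted hs) hD] at h0
  have h1 : P x (isIn (timeInverted α X) s D) = 0 := h0
  rw [isIn_timeInverted, hX.law hx hσ hD', densityMass_eq hx, ← nonpos_iff_eq_zero, ← not_lt,
    setLIntegral_pos_iff hm, not_lt, nonpos_iff_eq_zero] at h1
  have h2 : (fun z => s ^ α * z) ⁻¹' (D ∩ Ioi 0) ⊆
      Function.support (fun y => posDensity p (1 / s) x y) ∩ (fun z => s ^ α * z) ⁻¹' D := by
    rintro z ⟨hzD, hz⟩
    have hz : 0 < z := (mul_pos_iff_of_pos_left hc).1 hz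
    refine ⟨?_, hzD⟩
    rw [Function.mem_support, posDensity_of_pos p hx hz]
    exact (ENNReal.ofReal_pos.2 (hpos _ x z hσ hx hz)).ne'
  have h3 := measure_mono_null h2 h1
  rw [Real.volume_preimage_mul_left hc.ne', mul_eq_zero] at h3
  rw [Measure.restrict_apply hD]
  refine h3.resolve_left (ENNReal.ofReal_pos.2 ?_).ne'
  positivity

theorem IsMarkovProcess.ae_transition_eq (hX : IsMarkovProcess p P X)
    (hp : ContinuousOn (fun z : ℝ × ℝ × ℝ => p z.1 z.2.1 z.2.2) (Ioi 0 ×ˢ Ioi 0 ×ˢ Ioi 0))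
    (hpos : ∀ t x y, 0 < t → 0 < x → 0 < y → 0 < p t x y) {x s r : ℝ} (hx : 0 < x) (hs : 0 < s)
    (hr : 0 < r) {Q : ℝ → Kernel ℝ ℝ}
    (hQ : HasTransitions (timeInverted α X) (P x) (fun s t a C => Q (t - s) a C))
    {C : Set ℝ} (hC : MeasurableSet C) :
    ∀ᵐ a ∂(volume.restrict (Ioi 0)),
      Q r a C = densityMass (invertedDensity α p x s (s + r) a) C := by
  have := hX.isProbabilityMeasure x hx
  have hY := hX.measurable_timeInverted (α := α) hs
  have hst : s < s + r := by linarith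
  have hmI := measurable_posDensity (p := fun r => invertedDensity α p x s (s + r))
    (continuousOn_invertedDensity hp hpos hx hs) hr
  have hκ : Measurable fun a =>
      ∫⁻ y in C, posDensity (fun r => invertedDensity α p x s (s + r)) r a y :=
    hmI.lintegral_prod_right'
  -- Only at the pair of times (s, s + r) is the transition function replaced, by a version
  -- measurable in the state; uniqueness of conditional probabilities needs measurability there
  -- alone.
  have hT := (hX.hasTransitions_timeInverted hp hpos hx (α := α)).congr
    (κ' := fun s' t a C => if s' = s ∧ t = s + r then
      ∫⁻ y in C, posDensity (fun r => invertedDensity α p x s (s + r)) r a y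
      else densityMass (invertedDensity α p x s' t a) C) (by
      intro s' t hs' hst' D hD
      filter_upwards [hX.ae_pos_timeInverted (α := α) hx hs'] with ω hω a ha
      split_ifs with hc
      · obtain ⟨rfl, rfl⟩ := hc
        exact densityMass_eq (p := fun r => invertedDensity α p x s' (s' + r)) (hω a ha) D
      · rfl)
  have hfin : IsFiniteMeasure (aliveLaw (P x) (timeInverted α X s)) := by
    refine ⟨?_⟩
    rw [aliveLaw_apply hY MeasurableSet.univ]
    exact measure_lt_top _ _
  have hae : (fun a => Q r a C) =ᵐ[aliveLaw (P x) (timeInverted α X s)] fun a =>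
      ∫⁻ y in C, posDensity (fun r => invertedDensity α p x s (s + r)) r a y := by
    refine ae_eq_of_forall_setLIntegral_eq_of_sigmaFinite (Kernel.measurable_coe _ hC) hκ
      fun B hB _ => ?_
    have hB' := measurableSet_isIn (measurable_past (T := Ioi 0) (Y := timeInverted α X)
      (mem_Ioi.2 hs) le_rfl) hB
    have e1 := hQ s (s + r) hs hst _ hB' C hC
    have e2 := hT s (s + r) hs hst _ hB' C hC
    rw [e1] at e2
    simp only [add_sub_cancel_left, and_self, if_true] at e2
    have e3 : ∀ f : ℝ → ℝ≥0∞, Measurable f →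
        ∫⁻ ω in isIn (timeInverted α X) s B, onAlive f (timeInverted α X s ω) ∂(P x) =
          ∫⁻ a in B, f a ∂(aliveLaw (P x) (timeInverted α X s)) := by
      intro f hf
      rw [← univ_inter (isIn _ s B), setLIntegral_isIn hY hB, setLIntegral_univ,
        ← lintegral_aliveLaw hY (hf.indicator hB), lintegral_indicator hB]
    rw [← e3 _ (Kernel.measurable_coe _ hC), ← e3 _ hκ]
    exact e2
  filter_upwards [hX.ae_of_aliveLaw hp hpos hx hs hae, ae_restrict_mem measurableSet_Ioi]
    with a ha ha0
  rw [ha]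
  exact (densityMass_eq (p := fun r => invertedDensity α p x s (s + r)) ha0 C).symm

end Paths

/-! ### Homogeneity and stationarity of the densities -/

/-- Two densities that are continuous on `(0, ∞)²` are ordered if the masses are. -/
theorem le_of_ae_densityMass_eq {F G : ℝ → ℝ → ℝ}
    (hF : ContinuousOn (fun z : ℝ × ℝ => F z.1 z.2) (Ioi 0 ×ˢ Ioi 0))
    (hG : ContinuousOn (fun z : ℝ × ℝ => G z.1 z.2) (Ioi 0 ×ˢ Ioi 0))
    (hF0 : ∀ a b, 0 < a → 0 < b → 0 < F a b)
    (h : ∀ C, MeasurableSet C →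
      ∀ᵐ a ∂(volume.restrict (Ioi 0)), densityMass (F a) C = densityMass (G a) C)
    {a b : ℝ} (ha : 0 < a) (hb : 0 < b) : G a b ≤ F a b := by
  by_contra hlt
  rw [not_le] at hlt
  obtain ⟨m₁, h1, h2⟩ := exists_between hlt
  obtain ⟨m₂, h2, h3⟩ := exists_between h2
  have hnhds : (Ioi 0 ×ˢ Ioi 0 : Set (ℝ × ℝ)) ∈ nhds (a, b) :=
    (isOpen_Ioi.prod isOpen_Ioi).mem_nhds ⟨ha, hb⟩
  have e1 : ∀ᶠ z in nhds (a, b), F z.1 z.2 < m₁ :=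
    (hF.continuousAt hnhds).eventually (gt_mem_nhds h1)
  have e2 : ∀ᶠ z in nhds (a, b), m₂ < G z.1 z.2 :=
    (hG.continuousAt hnhds).eventually (lt_mem_nhds h3)
  obtain ⟨δ, hδ, hball⟩ := Metric.eventually_nhds_iff_ball.1 ((e1.and e2).and hnhds)
  have hbox : ∀ u v, u ∈ Metric.ball a δ → v ∈ Metric.ball b δ →
      (F u v < m₁ ∧ m₂ < G u v) ∧ 0 < u ∧ 0 < v := fun u v hu hv =>
    hball (u, v) (by rw [← ball_prod_same]; exact ⟨hu, hv⟩)
  -- The exceptional null set may depend on `C`, but one ball `C` around `b` is enough: by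
  -- continuity the strict inequality persists on a box, which contains a non-exceptional `u`.
  have hae := h (Metric.ball b δ) Metric.isOpen_ball.measurableSet
  rw [ae_restrict_iff' measurableSet_Ioi] at hae
  obtain ⟨u, hu, hmass⟩ : ∃ u ∈ Metric.ball a δ, 0 < u →
      densityMass (F u) (Metric.ball b δ) = densityMass (G u) (Metric.ball b δ) := by
    obtain ⟨u, hu, hu'⟩ := (Measure.dense_of_ae hae).inter_open_nonempty _ Metric.isOpen_ball
      ⟨a, Metric.mem_ball_self hδ⟩
    exact ⟨u, hu, hu'⟩
  have hu0 : 0 < u := (hbox u b hu (Metric.mem_ball_self hδ)).2.1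
  have hsub : Metric.ball b δ ∩ Ioi 0 = Metric.ball b δ :=
    inter_eq_left.2 fun v hv => (hbox u v hu hv).2.2
  have hm0 : 0 < m₁ := (hF0 a b ha hb).trans h1
  have hmass := hmass hu0
  rw [densityMass, densityMass, hsub] at hmass
  have hv : volume (Metric.ball b δ) = ENNReal.ofReal (2 * δ) := Real.volume_ball b δ
  have f1 : ∫⁻ y in Metric.ball b δ, ENNReal.ofReal (F u y) ≤
      ENNReal.ofReal m₁ * ENNReal.ofReal (2 * δ) := by
    rw [← hv, ← setLIntegral_const]
    exact setLIntegral_mono' Metric.isOpen_ball.measurableSet fun v hv =>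
      ENNReal.ofReal_le_ofReal (hbox u v hu hv).1.1.le
  have f2 : ENNReal.ofReal m₂ * ENNReal.ofReal (2 * δ) ≤
      ∫⁻ y in Metric.ball b δ, ENNReal.ofReal (G u y) := by
    rw [← hv, ← setLIntegral_const]
    exact setLIntegral_mono' Metric.isOpen_ball.measurableSet fun v hv =>
      ENNReal.ofReal_le_ofReal (hbox u v hu hv).1.2.le
  rw [← hmass] at f2
  have f3 := f2.trans f1
  rw [← ENNReal.ofReal_mul (hm0.trans h2).le, ← ENNReal.ofReal_mul hm0.le,
    ENNReal.ofReal_le_ofReal_iff (by positivity)] at f3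
  nlinarith

theorem densityMass_congr {f g : ℝ → ℝ} (h : ∀ b, 0 < b → f b = g b) {C : Set ℝ}
    (hC : MeasurableSet C) : densityMass f C = densityMass g C :=
  setLIntegral_congr_fun (hC.inter measurableSet_Ioi) fun b hb => by
    rw [h b hb.2]

/-- A measurable family of densities is the density of a Markov kernel wherever its mass is one. -/
theorem exists_markovKernel {f : ℝ → ℝ → ℝ≥0∞} (hf : Measurable (Function.uncurry f)) :
    ∃ Q : Kernel ℝ ℝ, IsMarkovKernel Q ∧ ∀ a, ∫⁻ y, f a y = 1 →
      ∀ C, MeasurableSet C → Q a C = ∫⁻ y in C, f a y := by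
  classical
  have hM : MeasurableSet {a | ∫⁻ y, f a y = 1} :=
    measurableSet_eq_fun hf.lintegral_prod_right' measurable_const
  let κ : Kernel ℝ ℝ := Kernel.withDensity (Kernel.const ℝ volume) f
  have hκ : ∀ a C, MeasurableSet C → κ a C = ∫⁻ y in C, f a y := by
    intro a C hC
    rw [Kernel.withDensity_apply _ hf, Kernel.const_apply, MeasureTheory.withDensity_apply _ hC]
  refine ⟨Kernel.piecewise hM κ (Kernel.const ℝ (Measure.dirac 0)), ⟨fun a => ⟨?_⟩⟩,
    fun a ha C hC => ?_⟩
  · rw [Kernel.piecewise_apply]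
    split_ifs with h
    · rw [hκ a univ MeasurableSet.univ, setLIntegral_univ]
      exact h
    · rw [Kernel.const_apply, measure_univ]
  · rw [Kernel.piecewise_apply, if_pos (show a ∈ {a | ∫⁻ y, f a y = 1} from ha), hκ a C hC]

section Paths

variable {Ω : Type*} [mΩ : MeasurableSpace Ω] {α : ℝ} {p : ℝ → ℝ → ℝ → ℝ} {P : ℝ → Measure Ω}
  {X : ℝ → Ω → State}

/-- The reversed transition probabilities have total mass one. -/
theorem IsMarkovProcess.ae_reversedMass_univ (hX : IsMarkovProcess p P X)
    (hp : ContinuousOn (fun z : ℝ × ℝ × ℝ => p z.1 z.2.1 z.2.2) (Ioi 0 ×ˢ Ioi 0 ×ˢ Ioi 0))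
    (hpos : ∀ t x y, 0 < t → 0 < x → 0 < y → 0 < p t x y) {x τ σ : ℝ} (hx : 0 < x) (hτ : 0 < τ)
    (hτσ : τ < σ) : ∀ᵐ ω ∂(P x), ∀ y, X σ ω = Sum.inl y → reversedMass p x τ σ y univ = 1 := by
  have hσ : 0 < σ := hτ.trans hτσ
  let N : Set ℝ := {y | reversedMass p x τ σ y univ ≠ 1} ∩ Ioi 0
  have hN : MeasurableSet N :=
    (measurableSet_eq_fun (measurable_reversedMass hp hτ hτσ univ)
      measurable_const).compl.inter measurableSet_Ioi
  -- Total mass one is the Chapman-Kolmogorov equation divided by p_σ(x, y), valid for almost every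
  -- y. Killing costs no mass in reversed time, where one conditions on being alive at the later
  -- time σ.
  have hN0 : volume N = 0 := by
    have hck := hX.chapmanKolmogorov_ae hp hx hτ (sub_pos.2 hτσ)
    refine measure_mono_null ?_ (ae_iff.1 hck)
    rintro y ⟨hy1, hy⟩ hy2
    refine hy1 ?_
    have hy : 0 < y := hy
    rw [add_sub_cancel] at hy2
    have h1 := posDensity_mul_reversedMass hpos hx hτ hτσ univ (y := y)
    rw [setLIntegral_univ, hy2, posDensity_of_pos p hx hy] at h1
    have h2 := hpos σ x y hσ hx hy
    rw [← ENNReal.mul_right_inj (ENNReal.ofReal_pos.2 h2).ne' ENNReal.ofReal_ne_top, h1, mul_one]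
  have hP : P x (isIn X σ N) = 0 := by
    rw [hX.law hx hσ hN, densityMass]
    exact setLIntegral_measure_zero _ _ (measure_mono_null inter_subset_left hN0)
  filter_upwards [measure_eq_zero_iff_ae_notMem.1 hP, hX.ae_pos hx hσ.le] with ω h1 h2 y hy
  by_contra hne
  exact h1 ⟨y, ⟨hne, h2 y hy⟩, hy.symm⟩

/-- By stationarity the density started at time 1 serves all initial times. It has mass one at
almost every state that is visited; elsewhere, and for r ≤ 0, a Dirac mass makes the kernel Markov
without affecting the transitions. -/
theorem IsMarkovProcess.isHomogeneousMarkov (hX : IsMarkovProcess p P X)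
    (hp : ContinuousOn (fun z : ℝ × ℝ × ℝ => p z.1 z.2.1 z.2.2) (Ioi 0 ×ˢ Ioi 0 ×ˢ Ioi 0))
    (hpos : ∀ t x y, 0 < t → 0 < x → 0 < y → 0 < p t x y) {x : ℝ} (hx : 0 < x)
    (hst : ∀ s s' r a b, 0 < s → 0 < s' → 0 < r → 0 < a → 0 < b →
      invertedDensity α p x s (s + r) a b = invertedDensity α p x s' (s' + r) a b) :
    IsHomogeneousMarkov (timeInverted α X) (P x) := by
  have hker : ∀ r, ∃ Q : Kernel ℝ ℝ, IsMarkovKernel Q ∧ (0 < r → ∀ a,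
      ∫⁻ y, posDensity (fun r => invertedDensity α p x 1 (1 + r)) r a y = 1 →
      ∀ C, MeasurableSet C →
        Q a C = ∫⁻ y in C, posDensity (fun r => invertedDensity α p x 1 (1 + r)) r a y) := by
    intro r
    by_cases hr : 0 < r
    · have hm := measurable_posDensity (p := fun r => invertedDensity α p x 1 (1 + r))
        (continuousOn_invertedDensity hp hpos hx one_pos) hr
      obtain ⟨Q, hQ, hQ'⟩ := exists_markovKernel
        (f := posDensity (fun r => invertedDensity α p x 1 (1 + r)) r) hm
      exact ⟨Q, hQ, fun _ => hQ'⟩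
    · exact ⟨Kernel.const ℝ (Measure.dirac 0), inferInstance, fun h => absurd h hr⟩
  choose Q hQ hQ' using hker
  refine ⟨Q, hQ, (hX.hasTransitions_timeInverted hp hpos hx).congr ?_⟩
  intro s t hs hlt C hC
  obtain ⟨r, rfl⟩ : ∃ r, t = s + r := ⟨t - s, by ring⟩
  have hr : 0 < r := by linarith
  have hmass : ∀ a, 0 < a → ∀ C, MeasurableSet C →
      densityMass (invertedDensity α p x s (s + r) a) C =
      ∫⁻ y in C, posDensity (fun r => invertedDensity α p x 1 (1 + r)) r a y := by
    intro a ha C hC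
    rw [← densityMass_eq (p := fun r => invertedDensity α p x 1 (1 + r)) ha C]
    exact densityMass_congr (fun b hb => hst s 1 r a b hs one_pos hr ha hb) hC
  filter_upwards [hX.ae_reversedMass_univ hp hpos hx (show 0 < 1 / (s + r) by positivity)
    (one_div_lt_one_div_of_lt hs hlt), hX.ae_pos hx (show 0 ≤ 1 / s by positivity)]
    with ω h1 h2 a ha
  rcases hXω : X (1 / s) ω with y | b
  · have hy := h2 y hXω
    have h3 := h1 y hXω
    rw [timeInverted, hXω, Sum.map_inl] at ha
    obtain rfl := Sum.inl_injective ha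
    have ha0 : 0 < s ^ α * y := by positivity
    rw [← preimage_univ (f := fun z => (s + r) ^ α * z),
      reversedMass_eq_densityMass hpos hx hs hlt hy MeasurableSet.univ,
      hmass _ ha0 _ MeasurableSet.univ,
      setLIntegral_univ] at h3
    rw [hmass _ ha0 C hC, add_sub_cancel_left, hQ' r hr _ h3 C hC]
  · rw [timeInverted, hXω, Sum.map_inr] at ha
    cases ha

/-- If the inverted process is homogeneous, then the inverted densities are stationary. -/
theorem IsMarkovProcess.invertedDensity_stationary (hX : IsMarkovProcess p P X)
    (hp : ContinuousOn (fun z : ℝ × ℝ × ℝ => p z.1 z.2.1 z.2.2) (Ioi 0 ×ˢ Ioi 0 ×ˢ Ioi 0))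
    (hpos : ∀ t x y, 0 < t → 0 < x → 0 < y → 0 < p t x y) {x : ℝ} (hx : 0 < x)
    (hhom : IsHomogeneousMarkov (timeInverted α X) (P x)) {s s' r a b : ℝ} (hs : 0 < s)
    (hs' : 0 < s') (hr : 0 < r) (ha : 0 < a) (hb : 0 < b) :
    invertedDensity α p x s (s + r) a b = invertedDensity α p x s' (s' + r) a b := by
  obtain ⟨Q, _, hQ⟩ := hhom
  have hc : ∀ s, 0 < s → ContinuousOn
      (fun z : ℝ × ℝ => invertedDensity α p x s (s + r) z.1 z.2) (Ioi 0 ×ˢ Ioi 0) := fun s hs =>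
    (continuousOn_invertedDensity hp hpos hx hs).comp (f := fun z : ℝ × ℝ => (r, z.1, z.2))
      (by fun_prop) fun z hz => ⟨hr, hz.1, hz.2⟩
  have key : ∀ s s', 0 < s → 0 < s' →
      invertedDensity α p x s' (s' + r) a b ≤ invertedDensity α p x s (s + r) a b := by
    intro s s' hs hs'
    refine le_of_ae_densityMass_eq (F := invertedDensity α p x s (s + r))
      (G := invertedDensity α p x s' (s' + r)) (hc s hs) (hc s' hs')
      (fun a b ha hb => invertedDensity_pos hpos hx hs (by linarith) ha hb) (fun C hC => ?_) ha hb
    filter_upwards [hX.ae_transition_eq hp hpos hx hs hr hQ hC,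
      hX.ae_transition_eq hp hpos hx hs' hr hQ hC] with a h1 h2
    rw [← h1, ← h2]
  exact le_antisymm (key s' s hs' hs) (key s s' hs hs')

end Paths

end TimeInversion

/-! ### The main theorem -/

theorem mainTheorem4 {Ω : Type*} [MeasurableSpace Ω] (α : ℝ) (hα : 0 < α)
    (p : ℝ → ℝ → ℝ → ℝ) (P : ℝ → Measure Ω) (X : ℝ → Ω → TimeInversion.State)
    (hX : TimeInversion.IsMarkovProcess p P X)
    (hpos : ∀ t x y, 0 < t → 0 < x → 0 < y → 0 < p t x y)
    (hdiff : TimeInversion.TwiceDifferentiable p) :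
    ((∀ x, 0 < x →
        TimeInversion.IsHomogeneousMarkov (TimeInversion.timeInverted α X) (P x)) ↔
      ∃ (φ : ℝ → ℝ) (β k : ℝ), 0 < k ∧
        TimeInversion.IsHTransform p (TimeInversion.modelDensity α β k φ)) ∧
    (∀ (φ : ℝ → ℝ) (β k : ℝ), 0 < k →
      TimeInversion.IsHTransform p (TimeInversion.modelDensity α β k φ) →
      ∀ x, 0 < x →
        TimeInversion.HasHomogeneousDensities (TimeInversion.timeInverted α X) (P x)
          (fun t a b => φ (x * b) / φ (x * a) * Real.exp (-t * (k ^ 2 / 2) * x ^ (2 / α)) *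
            TimeInversion.modelDensity α β k φ t a b) ∧
        ∀ s t a b, 0 < s → s < t → 0 < a → 0 < b →
          TimeInversion.invertedDensity α p x s t a b =
            φ (x * b) / φ (x * a) * Real.exp (-(t - s) * (k ^ 2 / 2) * x ^ (2 / α)) *
              TimeInversion.modelDensity α β k φ (t - s) a b) := by
  have hp := hdiff.continuousOn
  refine ⟨⟨fun hhom => ?_, ?_⟩, ?_⟩
  · obtain ⟨φ, h, β, κ, ν, hφ, hh, hform⟩ :=
      TimeInversion.exists_transformed_model hα hpos hdiff
        fun x s s' r a b hx hs hs' hr ha hb =>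
          hX.invertedDensity_stationary hp hpos hx (hhom x hx) hs hs' hr ha hb
    have hm := TimeInversion.measurable_posDensity hp one_pos
    have hκ : 0 < κ := TimeInversion.pos_of_chapmanKolmogorov hα hφ hh hform
      ((hm.comp (measurable_const.prodMk measurable_id)).mul
        (hm.comp (measurable_id.prodMk measurable_const)))
      fun x s t y hx hs ht hy => hX.chapmanKolmogorov_le hp hx hs ht hy
    -- k²/2 = κ, which requires κ > 0.
    refine ⟨φ, β, √(2 * κ), by positivity, h, ν, hh, fun t x y ht hx hy => ?_⟩
    rw [hform t x y ht hx hy, TimeInversion.modelDensity, Real.sq_sqrt (by positivity),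
      mul_div_cancel_left₀ _ two_ne_zero]
  · rintro ⟨φ, β, k, -, hT⟩ x hx
    refine hX.isHomogeneousMarkov hp hpos hx fun s s' r a b hs hs' hr ha hb => ?_
    rw [hT.invertedDensity_eq hα hpos hx hs (by linarith) ha hb,
      hT.invertedDensity_eq hα hpos hx hs' (by linarith) ha hb, add_sub_cancel_left,
      add_sub_cancel_left]
  · intro φ β k _ hT x hx
    refine ⟨(hX.hasTransitions_timeInverted hp hpos hx).congr fun s t hs hst C hC => ?_,
      fun s t a b hs hst ha hb => hT.invertedDensity_eq hα hpos hx hs hst ha hb⟩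
    filter_upwards [hX.ae_pos_timeInverted hx hs] with ω hω a ha
    exact TimeInversion.densityMass_congr
      (fun b hb => hT.invertedDensity_eq hα hpos hx hs hst (hω a ha) hb) hC
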